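/- Length functions on a group $K$ are maps $L:K\to\mathbb N$ with $L(e)=0$, $L(k^{-1})=L(k)$ and $L(kk')\le L(k)+L(k')$. For $f:\mathbb N\to\mathbb R$, $(K,L)$ has $f$-decay if $\|\lambda(x)\|\le f(n)\|x\|_2$ for every $n\in\mathbb N$ and every $x\in\mathbb C[K]$ supported on $\{k: L(k)\le n\}$, where $\lambda$ is the left regular representation on $\ell^2(K)$ and $\|\cdot\|$ the operator norm. $(K,L)$ has RD if it has $f$-decay for some polynomial $f$, and SD if it has $f$-decay for some $f\ge 0$ with $f(n)^{1/n}\to 1$; $K$ has RD (SD) if $(K,L)$ has RD (SD) for some length function $L$. Two length functions $L_1,L_2$ on $K$ are $g$-distorted if $L_1(k)\le g(L_2(k))$ and $L_2(k)\le g(L_1(k))$ for all $k\in K$. Let $G,H$ be groups with length functions $L_G,L_H$ and let $A$ be a common subgroup. For $k\in G*_AH$ let $L^U(k)$ be the minimum of $\sum_i L_i(k_i)$ over all factorizations $k=\prod_i k_i$ with $k_i\in G\cup H$, where $L_i=L_G$ if $k_i\in G\setminus A$, $L_i=L_H$ if $k_i\in H\setminus A$, and $L_i$ is freely chosen among $L_G,L_H$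 if $k_i\in A$. Then $L^U$ is a length function on $G*_AH$. Let $j:\mathbb N\to\mathbb R$, and suppose that $(L_G|_A,L_H|_A)$ are $(x+j(x))$-distorted on $A$. Consider the condition (P) elements of $G$ or $H$ of length zero lie in $A$, and $L_G(a)=0\iff L_H(a)=0$ for $a\in A$ (for example, $L_G$ and $L_H$ vanish only at the identity). (0) Suppose that (P) holds, that $j$ is nondecreasing and that $j(x)/x$ is nonincreasing on $x\ge1$. If $(G,L_G)$ and $(H,L_H)$ both have $f$-decay, then $(G*_AH,L^U)$ has $\tilde f\circ\bigl(x\exp(j(x))\bigr)$-decay, where $\tilde f(x)=(2x+1)^{7/2}f(2x)$ and $f$ is evaluated at a real number by rounding it down. (1) If $j(x)=O(\ln x)$ and $(G,L_G)$, $(H,L_H)$ have RD, then $G*_AH$ has RD. (2) If $j(x)=o(x)$ and $(G,L_G)$, $(H,L_H)$ have RD, then $G*_AH$ has SD. (3) If $j(x)=O(1)$ and $(G,L_G)$, $(H,L_H)$ have SD, then $G*_AH$ has SD. In (1)-(3) no further condition is placed on $j$; if moreover (P) holds, then $L^U$ is a length function witnessing the conclusion. -/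

import Mathlib

open Filter Topology Asymptotics

universe u v

/-! ## Length functions and distortion -/

/-- An (integer valued) length function on a group. No properness is demanded, and nontrivial
elements may have length zero. -/
structure IsLengthFunction {K : Type*} [Group K] (l : K → ℕ) : Prop where
  one : l 1 = 0
  inv : ∀ k, l k⁻¹ = l k
  mul_le : ∀ k₁ k₂, l (k₁ * k₂) ≤ l k₁ + l k₂

/-- Two length functions are `g`-distorted if each is bounded by `g` of the other. -/
def IsDistorted {K : Type*} (g : ℕ → ℝ) (l₁ l₂ : K → ℕ) : Prop :=
  ∀ k, (l₁ k : ℝ) ≤ g (l₂ k) ∧ (l₂ k : ℝ) ≤ g (l₁ k)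

/-! ## The left regular representation and decay -/

section Regular

variable {K : Type*} [Group K]

theorem memlp_leftTranslate (g : K) (ξ : lp (fun _ : K => ℂ) 2) :
    Memℓp (fun k => ξ (g⁻¹ * k)) 2 := by
  have h := (memℓp_gen_iff (p := 2) (by norm_num)).1 (lp.memℓp ξ)
  refine (memℓp_gen_iff (p := 2) (by norm_num)).2 ?_
  exact (Equiv.mulLeft g⁻¹).summable_iff.2 h

/-- The unitary `λ(g)` on `ℓ²(K)`, `(λ(g) ξ)(k) = ξ(g⁻¹ k)`, as a linear isometry. -/
noncomputable def leftTranslate (g : K) :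
    lp (fun _ : K => ℂ) 2 →ₗᵢ[ℂ] lp (fun _ : K => ℂ) 2 where
  toFun ξ := ⟨fun k => ξ (g⁻¹ * k), memlp_leftTranslate g ξ⟩
  map_add' _ _ := rfl
  map_smul' _ _ := rfl
  norm_map' ξ := by
    rw [lp.norm_eq_tsum_rpow (p := 2) (by norm_num), lp.norm_eq_tsum_rpow (p := 2) (by norm_num)]
    congr 1
    exact (Equiv.mulLeft g⁻¹).tsum_eq (fun k => ‖ξ k‖ ^ (2 : ENNReal).toReal)

/-- The operator `λ(x) = ∑ g, x(g) λ(g)` on `ℓ²(K)` given by an element `x` of the group ring. -/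
noncomputable def regularRep (x : MonoidAlgebra ℂ K) :
    lp (fun _ : K => ℂ) 2 →L[ℂ] lp (fun _ : K => ℂ) 2 :=
  ∑ g ∈ x.coeff.support, x.coeff g • (leftTranslate g).toContinuousLinearMap

/-- The `2`-norm of an element of the group ring. -/
noncomputable def twoNorm (x : MonoidAlgebra ℂ K) : ℝ :=
  Real.sqrt (∑ g ∈ x.coeff.support, ‖x.coeff g‖ ^ 2)

/-- `(K, l)` has `f`-decay: `‖λ(x)‖ ≤ f(n) ‖x‖₂` for `x` supported on the `l`-ball of radius `n`. -/
def HasDecay (l : K → ℕ) (f : ℕ → ℝ) : Prop :=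
  ∀ (n : ℕ) (x : MonoidAlgebra ℂ K), (∀ g ∈ x.coeff.support, l g ≤ n) →
    ‖regularRep x‖ ≤ f n * twoNorm x

/-- A function `f : ℕ → ℝ≥0` is subexponential if `f(n)^(1/n) → 1`. -/
def IsSubexponential (f : ℕ → ℝ) : Prop :=
  (∀ n, 0 ≤ f n) ∧ Tendsto (fun n : ℕ => f n ^ (1 / (n : ℝ))) atTop (𝓝 1)

/-- Rapid decay with respect to a given length function. -/
def HasRDWith (l : K → ℕ) : Prop :=
  ∃ p : Polynomial ℝ, HasDecay l (fun n => p.eval (n : ℝ))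

/-- Subexponential decay with respect to a given length function. -/
def HasSDWith (l : K → ℕ) : Prop :=
  ∃ f : ℕ → ℝ, IsSubexponential f ∧ HasDecay l f

variable (K) in
/-- Property RD: rapid decay with respect to some length function. -/
def HasRD : Prop := ∃ l : K → ℕ, IsLengthFunction l ∧ HasRDWith l

variable (K) in
/-- Property SD: subexponential decay with respect to some length function. -/
def HasSD : Prop := ∃ l : K → ℕ, IsLengthFunction l ∧ HasSDWith l

end Regular

/-! ## The amalgamated free product -/

/-- The family consisting of the two groups `G` and `H`. -/
def GroupPair (G H : Type u) : Bool → Type u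
  | false => G
  | true => H

instance GroupPair.instGroup (G H : Type u) [Group G] [Group H] : ∀ b, Group (GroupPair G H b)
  | false => inferInstanceAs (Group G)
  | true => inferInstanceAs (Group H)

section Amalgam

variable {A : Type v} {G H : Type u} [Group A] [Group G] [Group H]

/-- The two embeddings of the amalgam, as a family. -/
def pairHom (iG : A →* G) (iH : A →* H) : ∀ b, A →* GroupPair G H b
  | false => iG
  | true => iH

/-- The amalgamated free product `G *_A H`. -/
abbrev Amalgam (iG : A →* G) (iH : A →* H) : Type _ := Monoid.PushoutI (pairHom iG iH)

/-- The canonical map `G → G *_A H`. -/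
def Amalgam.inG (iG : A →* G) (iH : A →* H) : G →* Amalgam iG iH :=
  Monoid.PushoutI.of (φ := pairHom iG iH) false

/-- The canonical map `H → G *_A H`. -/
def Amalgam.inH (iG : A →* G) (iH : A →* H) : H →* Amalgam iG iH :=
  Monoid.PushoutI.of (φ := pairHom iG iH) true

/-- The product in `G *_A H` of a word with letters in `G` and `H`. -/
def wordProd (iG : A →* G) (iH : A →* H) (w : List (G ⊕ H)) : Amalgam iG iH :=
  (w.map (Sum.elim (Amalgam.inG iG iH) (Amalgam.inH iG iH))).prod

/-- The total length of a word. An element of `A` may appear as a letter of `G`, measured by `LG`,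
or as a letter of `H`, measured by `LH`. -/
def wordLength (LG : G → ℕ) (LH : H → ℕ) (w : List (G ⊕ H)) : ℕ :=
  (w.map (Sum.elim LG LH)).sum

/-- The universal length function `L^U` on `G *_A H`: the minimal total length of a word
representing the given element (every element is represented, see `exists_wordProd_eq`). -/
noncomputable def universalLength (iG : A →* G) (iH : A →* H) (LG : G → ℕ) (LH : H → ℕ)
    (k : Amalgam iG iH) : ℕ :=
  sInf {n | ∃ w : List (G ⊕ H), wordProd iG iH w = k ∧ wordLength LG LH w = n}

theorem exists_wordProd_eq (iG : A →* G) (iH : A →* H) (k : Amalgam iG iH) :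
    ∃ w : List (G ⊕ H), wordProd iG iH w = k := by
  induction k using Monoid.PushoutI.induction_on with
  | of b g =>
    cases b with
    | false => exact ⟨[Sum.inl g], by simp [wordProd]; rfl⟩
    | true => exact ⟨[Sum.inr g], by simp [wordProd]; rfl⟩
  | base a =>
    refine ⟨[Sum.inl (iG a)], ?_⟩
    rw [← Monoid.PushoutI.of_apply_eq_base (pairHom iG iH) false a]
    simp [wordProd, Amalgam.inG, pairHom]
    rfl
  | mul x y hx hy =>
    obtain ⟨w, rfl⟩ := hx
    obtain ⟨w', rfl⟩ := hy
    exact ⟨w ++ w', by simp [wordProd]⟩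

/-- Elements of length zero lie in the amalgam, and on the amalgam the two length functions have
the same zeros. This holds in particular if `LG` and `LH` vanish only at the identity. -/
structure ZerosInAmalgam (iG : A →* G) (iH : A →* H) (LG : G → ℕ) (LH : H → ℕ) : Prop where
  left : ∀ g, LG g = 0 → ∃ a, iG a = g
  right : ∀ h, LH h = 0 → ∃ a, iH a = h
  iff : ∀ a, LG (iG a) = 0 ↔ LH (iH a) = 0

end Amalgam

/-- `f̃(x) = (2x+1)^(7/2) f(2x)`, for real `x ≥ 0`; a function of an integer radius is evaluated at
a real radius by rounding down (balls for integer valued lengths do not change thereby). -/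
noncomputable def decayTilde (f : ℕ → ℝ) (x : ℝ) : ℝ :=
  (2 * x + 1) ^ (7 / 2 : ℝ) * f ⌊2 * x⌋₊

open scoped ENNReal

/-!
Let `c = j n / n`. An element of `L^U`-length at most `n` is brought into alternating normal form by
absorbing letters from the common subgroup into their neighbours. Each absorption may pass from one
length function to the other, which multiplies the length by at most `1 + c`, and uses up at least
one unit of length, so at most `n` of them occur and the total length grows at most to
`n (1 + c) ^ n ≤ n e^{j n}`.

Decay for `f` is the bound `‖X ∗ Y‖₂ ≤ f n ‖X‖₂ ‖Y‖₂` for nonnegative `X` supported in the ball of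
radius `n`. If `z = u v` with `u` alternating, the normal form of `u` is `W₁ M W₂` with at most one
letter in `M`, where `z` begins with the coset of `W₁` and `v` begins with the coset of `W₂⁻¹`.
Representing these two cosets by words of minimal length turns `u` into an element of one of the two
groups, of length at most `2 n e^{j n}`. For given numbers of letters in `W₁` and `W₂` and a given
group, the contribution of such factorizations is therefore an orthogonal sum of convolutions in
that group. There are `(n + 1) ^ 2 + n ^ 2` choices, whence decay for
`((n + 1) ^ 2 + n ^ 2) f (2 n e^{j n})`, which is better than the stated bound.

For the special cases, `j` is replaced by a larger function of the same growth that is nondecreasing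
with `j n / n` nonincreasing; without the condition on elements of length zero, both length
functions are first increased by one off the identity.
-/

/-! ## The `ℓ²`-norm on nonnegative functions -/

section L2Norm

variable {ι κ : Type*}

/-- The `ℓ²`-norm, possibly infinite, of a function with values in `[0, ∞]`. Norms of convolutions
are estimated with these values, so that no summability has to be carried along. -/
noncomputable def l2Norm (f : ι → ℝ≥0∞) : ℝ≥0∞ :=
  (∑' i, f i ^ 2) ^ (1 / 2 : ℝ)

theorem l2Norm_sq (f : ι → ℝ≥0∞) : l2Norm f ^ 2 = ∑' i, f i ^ 2 := by
  rw [l2Norm, ← ENNReal.rpow_natCast, ← ENNReal.rpow_mul]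
  norm_num

theorem l2Norm_le_of_tsum_sq_le {f : ι → ℝ≥0∞} {a : ℝ≥0∞} (h : ∑' i, f i ^ 2 ≤ a ^ 2) :
    l2Norm f ≤ a := by
  rwa [← ENNReal.pow_le_pow_left_iff two_ne_zero, l2Norm_sq]

theorem le_l2Norm (f : ι → ℝ≥0∞) (i : ι) : f i ≤ l2Norm f := by
  rw [← ENNReal.pow_le_pow_left_iff two_ne_zero, l2Norm_sq]
  exact ENNReal.le_tsum i

@[gcongr]
theorem l2Norm_mono {f g : ι → ℝ≥0∞} (h : ∀ i, f i ≤ g i) : l2Norm f ≤ l2Norm g := by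
  unfold l2Norm
  gcongr
  exact h _

theorem l2Norm_const_mul (c : ℝ≥0∞) (f : ι → ℝ≥0∞) : l2Norm (fun i => c * f i) = c * l2Norm f := by
  simp only [l2Norm, mul_pow, ENNReal.tsum_mul_left]
  rw [ENNReal.mul_rpow_of_nonneg _ _ (by norm_num), ← ENNReal.rpow_natCast, ← ENNReal.rpow_mul]
  norm_num

theorem l2Norm_comp_equiv (e : κ ≃ ι) (f : ι → ℝ≥0∞) : l2Norm (f ∘ e) = l2Norm f :=
  congrArg (· ^ (1 / 2 : ℝ)) (e.tsum_eq fun i => f i ^ 2)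

theorem l2Norm_comp_le {φ : κ → ι} (hφ : Function.Injective φ) (f : ι → ℝ≥0∞) :
    l2Norm (f ∘ φ) ≤ l2Norm f := by
  refine l2Norm_le_of_tsum_sq_le ?_
  rw [l2Norm_sq]
  exact ENNReal.tsum_comp_le_tsum_of_injective hφ fun i => f i ^ 2

theorem l2Norm_l2Norm (F : ι → κ → ℝ≥0∞) :
    l2Norm (fun i => l2Norm (F i)) = l2Norm fun x : ι × κ => F x.1 x.2 := by
  rw [l2Norm, l2Norm, ENNReal.tsum_prod']
  simp only [l2Norm_sq]

theorem l2Norm_diagonal_le (F : κ → ι → ℝ≥0∞) (φ : ι → κ) :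
    l2Norm (fun i => F (φ i) i) ≤ l2Norm fun k => l2Norm (F k) := by
  refine l2Norm_le_of_tsum_sq_le ?_
  simp_rw [l2Norm_sq]
  rw [ENNReal.tsum_comm]
  exact ENNReal.tsum_le_tsum fun i => ENNReal.le_tsum (f := fun k => F k i ^ 2) (φ i)

theorem l2Norm_indicator_fiber_le (f : ι → ℝ≥0∞) (φ : ι → κ) {T : κ → Set ι}
    (hT : ∀ k, ∀ i ∈ T k, φ i = k) :
    l2Norm (fun k => l2Norm ((T k).indicator f)) ≤ l2Norm f := by
  classical
  refine l2Norm_le_of_tsum_sq_le ?_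
  simp_rw [l2Norm_sq]
  rw [ENNReal.tsum_comm]
  refine ENNReal.tsum_le_tsum fun i => ?_
  calc ∑' k, (T k).indicator f i ^ 2 ≤ ∑' k, if k = φ i then f i ^ 2 else 0 := by
        refine ENNReal.tsum_le_tsum fun k => ?_
        by_cases hi : i ∈ T k
        · simp [hi, hT k i hi]
        · simp [hi]
    _ = f i ^ 2 := tsum_ite_eq _ _

theorem tsum_mul_le_l2Norm_mul_l2Norm (f g : ι → ℝ≥0∞) :
    ∑' i, f i * g i ≤ l2Norm f * l2Norm g := by
  rw [ENNReal.tsum_eq_iSup_sum]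
  refine iSup_le fun s =>
    (ENNReal.inner_le_Lp_mul_Lq s f g Real.HolderConjugate.two_two).trans ?_
  simp only [ENNReal.rpow_ofNat]
  unfold l2Norm
  gcongr <;> exact ENNReal.sum_le_tsum s

theorem l2Norm_tsum_le (F : ι → κ → ℝ≥0∞) :
    l2Norm (fun c => ∑' i, F i c) ≤ ∑' i, l2Norm (F i) := by
  have square_expand : ∀ f : ι → ℝ≥0∞, (∑' i, f i) ^ 2 = ∑' i, ∑' i', f i * f i' := fun f => by
    simp only [sq, ENNReal.tsum_mul_left, ENNReal.tsum_mul_right]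
  refine l2Norm_le_of_tsum_sq_le ?_
  calc ∑' c, (∑' i, F i c) ^ 2 = ∑' i, ∑' i', ∑' c, F i c * F i' c := by
        simp only [square_expand]
        rw [ENNReal.tsum_comm]
        exact tsum_congr fun i => ENNReal.tsum_comm
    _ ≤ ∑' i, ∑' i', l2Norm (F i) * l2Norm (F i') := by
        gcongr
        exact tsum_mul_le_l2Norm_mul_l2Norm _ _
    _ = (∑' i, l2Norm (F i)) ^ 2 := (square_expand _).symm

theorem l2Norm_finset_sum_le (s : Finset ι) (F : ι → κ → ℝ≥0∞) :
    l2Norm (fun c => ∑ i ∈ s, F i c) ≤ ∑ i ∈ s, l2Norm (F i) := by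
  simp only [← Finset.tsum_subtype]
  exact l2Norm_tsum_le _

end L2Norm

/-! ## Convolution -/

section Convolution

variable {Γ : Type*} [Group Γ]

/-- The convolution of two functions on a group with values in `[0, ∞]`. -/
noncomputable def groupConvolution (X Y : Γ → ℝ≥0∞) (c : Γ) : ℝ≥0∞ :=
  ∑' g, X g * Y (g⁻¹ * c)

/-- Convolution by a finitely supported nonnegative function `X` with support in `B` is bounded on
`ℓ²(Γ)` by `C ‖X‖₂`. For balls `B` this is the decay inequality, see `hasDecay_of_convolutionBound`
and `HasDecay.convolutionBound`. -/
def ConvolutionBound (B : Set Γ) (C : ℝ≥0∞) : Prop :=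
  ∀ X Y : Γ → ℝ≥0∞, (Function.support X).Finite → (∀ g, X g ≠ ∞) → Function.support X ⊆ B →
    l2Norm Y ≠ ∞ → l2Norm (groupConvolution X Y) ≤ C * l2Norm X * l2Norm Y

theorem ConvolutionBound.mono {B B' : Set Γ} {C C' : ℝ≥0∞} (h : ConvolutionBound B C)
    (hB : B' ⊆ B) (hC : C ≤ C') : ConvolutionBound B' C' :=
  fun X Y hX hX' hXB hY => (h X Y hX hX' (hXB.trans hB) hY).trans (by gcongr)

theorem groupConvolution_translate (X Y : Γ → ℝ≥0∞) (α β c : Γ) :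
    groupConvolution (fun g => X (α * g * β⁻¹)) (fun w => Y (β * w)) (α⁻¹ * c) =
      groupConvolution X Y c := by
  let e : Γ ≃ Γ := (Equiv.mulLeft α).trans (Equiv.mulRight β⁻¹)
  refine Eq.trans (tsum_congr fun g => ?_) (e.tsum_eq fun u => X u * Y (u⁻¹ * c))
  have : β * (g⁻¹ * (α⁻¹ * c)) = (α * g * β⁻¹)⁻¹ * c := by group
  simp only [e, Equiv.trans_apply, Equiv.coe_mulLeft, Equiv.coe_mulRight, this]

theorem ConvolutionBound.translate {B : Set Γ} {C : ℝ≥0∞} (h : ConvolutionBound B C) (α β : Γ) :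
    ConvolutionBound {u | α⁻¹ * u * β ∈ B} C := by
  intro X Y hX hX' hXB hY
  let e : Γ ≃ Γ := (Equiv.mulLeft α).trans (Equiv.mulRight β⁻¹)
  calc l2Norm (groupConvolution X Y)
      = l2Norm (groupConvolution (X ∘ e) (Y ∘ Equiv.mulLeft β) ∘ Equiv.mulLeft α⁻¹) :=
        congrArg l2Norm (funext fun c => (groupConvolution_translate X Y α β c).symm)
    _ = l2Norm (groupConvolution (X ∘ e) (Y ∘ Equiv.mulLeft β)) := l2Norm_comp_equiv _ _
    _ ≤ C * l2Norm (X ∘ e) * l2Norm (Y ∘ Equiv.mulLeft β) := by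
        refine h _ _ (hX.preimage e.injective.injOn) (fun g => hX' _) (fun g hg => ?_) ?_
        · have : α⁻¹ * (α * g * β⁻¹) * β ∈ B := hXB hg
          simpa [mul_assoc] using this
        · rwa [l2Norm_comp_equiv]
    _ = C * l2Norm X * l2Norm Y := by simp only [l2Norm_comp_equiv]

/-- The part of the convolution of `x` and `y` at `z` coming from those factorizations
`z = u (u⁻¹ z)` for which the markers `p` of `u` and `z` agree, the markers `q` of `u⁻¹` and
`u⁻¹ z` agree, and `u` lies in `p u * B * (q u⁻¹)⁻¹`. -/
noncomputable def markedConvolution (B : Set Γ) (p q : Γ → Γ) (x y : Γ → ℝ≥0∞) (z : Γ) : ℝ≥0∞ :=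
  ∑' β, groupConvolution ({u | p u = p z ∧ q u⁻¹ = β ∧ (p z)⁻¹ * u * β ∈ B}.indicator x)
    ({w | q w = β}.indicator y) z

theorem tsum_indicator_le_markedConvolution (B : Set Γ) (p q : Γ → Γ) (x y : Γ → ℝ≥0∞) (z : Γ) :
    ∑' u, {u | p u = p z ∧ q u⁻¹ = q (u⁻¹ * z) ∧ (p u)⁻¹ * u * q u⁻¹ ∈ B}.indicator
      (fun u => x u * y (u⁻¹ * z)) u ≤ markedConvolution B p q x y z := by
  unfold markedConvolution groupConvolution
  rw [ENNReal.tsum_comm]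
  refine ENNReal.tsum_le_tsum fun u =>
    Set.indicator_apply_le' (fun hu => ?_) fun _ => zero_le
  refine le_trans (le_of_eq ?_) (ENNReal.le_tsum (q u⁻¹))
  rw [Set.indicator_of_mem (s := {u' | p u' = p z ∧ _}) ⟨hu.1, rfl, hu.1 ▸ hu.2.2⟩,
    Set.indicator_of_mem (s := {w | q w = _}) hu.2.1.symm]

/-- Orthogonality over the values of `p` and Cauchy–Schwarz over the values of `q` recombine the
pieces without loss in the constant. -/
theorem ConvolutionBound.markedConvolution_le {B : Set Γ} {C : ℝ≥0∞} (hB : ConvolutionBound B C)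
    (p q : Γ → Γ) {x y : Γ → ℝ≥0∞} (hx : (Function.support x).Finite) (hx' : ∀ g, x g ≠ ∞)
    (hy : l2Norm y ≠ ∞) :
    l2Norm (markedConvolution B p q x y) ≤ C * l2Norm x * l2Norm y := by
  let X : Γ → Γ → Γ → ℝ≥0∞ := fun α β =>
    {u | p u = α ∧ q u⁻¹ = β ∧ α⁻¹ * u * β ∈ B}.indicator x
  let Y : Γ → Γ → ℝ≥0∞ := fun β => {w | q w = β}.indicator y
  have hX : l2Norm (fun α => l2Norm fun β => l2Norm (X α β)) ≤ l2Norm x := by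
    rw [l2Norm_l2Norm fun α β => l2Norm (X α β)]
    exact l2Norm_indicator_fiber_le x (fun u => (p u, q u⁻¹)) fun k u hu => Prod.ext hu.1 hu.2.1
  have hY : l2Norm (fun β => l2Norm (Y β)) ≤ l2Norm y :=
    l2Norm_indicator_fiber_le y q fun _ _ h => h
  have hXY (α β : Γ) : l2Norm (groupConvolution (X α β) (Y β))
      ≤ C * (l2Norm (X α β) * l2Norm (Y β)) := by
    rw [← mul_assoc]
    refine hB.translate α β _ _ (hx.subset (by simp [X]))
      (fun g => ne_top_of_le_ne_top (hx' g) (Set.indicator_le_self _ _ g))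
      (fun u hu => (Set.mem_of_indicator_ne_zero hu).2.2)
      (ne_top_of_le_ne_top hy (l2Norm_mono (Set.indicator_le_self _ _)))
  calc l2Norm (markedConvolution B p q x y)
      ≤ l2Norm fun α => l2Norm fun z => ∑' β, groupConvolution (X α β) (Y β) z :=
        l2Norm_diagonal_le (fun α z => ∑' β, groupConvolution (X α β) (Y β) z) p
    _ ≤ l2Norm fun α => ∑' β, C * (l2Norm (X α β) * l2Norm (Y β)) := by
        refine l2Norm_mono fun α => (l2Norm_tsum_le _).trans (ENNReal.tsum_le_tsum (hXY α))
    _ ≤ l2Norm fun α => C * l2Norm y * l2Norm fun β => l2Norm (X α β) := by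
        refine l2Norm_mono fun α => ?_
        rw [ENNReal.tsum_mul_left, mul_assoc, mul_comm (l2Norm y)]
        gcongr
        exact (tsum_mul_le_l2Norm_mul_l2Norm _ _).trans (by gcongr)
    _ ≤ C * l2Norm x * l2Norm y := by
        rw [l2Norm_const_mul, mul_right_comm]
        gcongr

theorem ConvolutionBound.of_markers {ι : Type*} (s : Finset ι) (B : ι → Set Γ) (p q : ι → Γ → Γ)
    {C : ℝ≥0∞} (hB : ∀ i ∈ s, ConvolutionBound (B i) C) {U : Set Γ}
    (hU : ∀ u ∈ U, ∀ z, ∃ i ∈ s, p i u = p i z ∧ q i u⁻¹ = q i (u⁻¹ * z) ∧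
      (p i u)⁻¹ * u * q i u⁻¹ ∈ B i) :
    ConvolutionBound U (s.card * C) := by
  intro x y hx hx' hxU hy
  have le_sum_marked (z : Γ) : groupConvolution x y z ≤
      ∑ i ∈ s, markedConvolution (B i) (p i) (q i) x y z := by
    refine le_trans ?_
      (Finset.sum_le_sum fun i _ => tsum_indicator_le_markedConvolution (B i) (p i) (q i) x y z)
    rw [← Summable.tsum_finsetSum fun _ _ => ENNReal.summable]
    refine ENNReal.tsum_le_tsum fun u => ?_
    by_cases hu : x u = 0
    · simp [hu]
    obtain ⟨i, hi, hiu⟩ := hU u (hxU hu) z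
    refine le_trans ?_ (Finset.single_le_sum (fun _ _ => zero_le) hi)
    rw [Set.indicator_of_mem (by exact hiu)]
  calc l2Norm (groupConvolution x y)
      ≤ ∑ i ∈ s, l2Norm (markedConvolution (B i) (p i) (q i) x y) :=
        (l2Norm_mono le_sum_marked).trans (l2Norm_finset_sum_le _ _)
    _ ≤ ∑ _ ∈ s, C * l2Norm x * l2Norm y :=
        Finset.sum_le_sum fun i hi => (hB i hi).markedConvolution_le (p i) (q i) hx hx' hy
    _ = s.card * C * l2Norm x * l2Norm y := by
        rw [Finset.sum_const, nsmul_eq_mul]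
        ring

theorem l2Norm_eq_l2Norm_cosets {K : Type*} [Group K] {φ : K →* Γ} (hφ : Function.Injective φ)
    {T : Set Γ} (hT : Subgroup.IsComplement (φ.range : Set Γ) T) (Z : Γ → ℝ≥0∞) :
    l2Norm Z = l2Norm fun t : T => l2Norm fun k => Z (φ k * t) := by
  let e : T × K ≃ Γ := (Equiv.prodComm _ _).trans
    ((Equiv.prodCongr (MonoidHom.ofInjective hφ).toEquiv (Equiv.refl T)).trans hT.equiv.symm)
  rw [← l2Norm_comp_equiv e, l2Norm_l2Norm]
  rfl

theorem groupConvolution_map_mul {K : Type*} [Group K] {φ : K →* Γ} (hφ : Function.Injective φ)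
    {X : Γ → ℝ≥0∞} (hX : Function.support X ⊆ Set.range φ) (Y : Γ → ℝ≥0∞) (t : Γ) (c : K) :
    groupConvolution X Y (φ c * t) = groupConvolution (X ∘ φ) (fun k => Y (φ k * t)) c := by
  have hsupp : (Function.support fun g => X g * Y (g⁻¹ * (φ c * t))) ⊆ Set.range φ :=
    fun g hg => hX fun h0 => hg (by simp [h0])
  simp only [groupConvolution, ← hφ.tsum_eq hsupp, Function.comp_apply, map_mul, map_inv, mul_assoc]

/-- On each right coset of the image of `φ` the convolution is a convolution on `K`. -/
theorem ConvolutionBound.map {K : Type*} [Group K] {B : Set K} {C : ℝ≥0∞}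
    (h : ConvolutionBound B C) {φ : K →* Γ} (hφ : Function.Injective φ) :
    ConvolutionBound (φ '' B) C := by
  intro X Y hX hX' hXB hY
  obtain ⟨T, hT, -⟩ := φ.range.exists_isComplement_right 1
  have hsupp : Function.support (X ∘ φ) ⊆ B := fun k hk => by
    obtain ⟨k', hk', hkk'⟩ := hXB (show φ k ∈ Function.support X from hk)
    rwa [← hφ hkk']
  have hcoset (t : T) : l2Norm (groupConvolution (X ∘ φ) fun k => Y (φ k * t))
      ≤ C * l2Norm X * l2Norm fun k => Y (φ k * t) := by
    have hYt : l2Norm (fun k => Y (φ k * t)) ≠ ∞ :=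
      ne_top_of_le_ne_top hY (l2Norm_comp_le ((mul_left_injective (t : Γ)).comp hφ) Y)
    refine (h (X ∘ φ) _ (hX.preimage hφ.injOn) (fun _ => hX' _) hsupp hYt).trans ?_
    gcongr
    exact l2Norm_comp_le hφ X
  calc l2Norm (groupConvolution X Y)
      = l2Norm fun t : T => l2Norm (groupConvolution (X ∘ φ) fun k => Y (φ k * t)) := by
        simp only [l2Norm_eq_l2Norm_cosets hφ hT,
          groupConvolution_map_mul hφ (hXB.trans (Set.image_subset_range φ B))]
    _ ≤ l2Norm fun t : T => C * l2Norm X * l2Norm fun k => Y (φ k * t) := l2Norm_mono hcoset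
    _ = C * l2Norm X * l2Norm Y := by rw [l2Norm_const_mul, ← l2Norm_eq_l2Norm_cosets hφ hT]

end Convolution

/-! ## Decay and convolution bounds -/

section Decay

variable {K : Type*}

theorem twoNorm_nonneg (x : MonoidAlgebra ℂ K) : 0 ≤ twoNorm x := Real.sqrt_nonneg _

theorem l2Norm_enorm (ξ : lp (fun _ : K => ℂ) 2) : l2Norm (fun k => ‖ξ k‖ₑ) = ‖ξ‖ₑ := by
  have hsum : HasSum (fun k => ‖ξ k‖ ^ 2) (‖ξ‖ ^ 2) := by
    simpa using lp.hasSum_norm (p := 2) (by norm_num) ξ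
  rw [l2Norm]
  simp only [← ofReal_norm, ← ENNReal.ofReal_pow (norm_nonneg _)]
  rw [← ENNReal.ofReal_tsum_of_nonneg (fun _ => sq_nonneg _) hsum.summable, hsum.tsum_eq,
    ENNReal.ofReal_pow (norm_nonneg _), ← ENNReal.rpow_natCast, ← ENNReal.rpow_mul]
  norm_num

theorem l2Norm_enorm_coeff (x : MonoidAlgebra ℂ K) :
    l2Norm (fun g => ‖x.coeff g‖ₑ) = ENNReal.ofReal (twoNorm x) := by
  have hsum : ∑' g, ‖x.coeff g‖ₑ ^ 2 = ENNReal.ofReal (∑ g ∈ x.coeff.support, ‖x.coeff g‖ ^ 2) := by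
    rw [tsum_eq_sum (s := x.coeff.support) fun g hg => by simp [Finsupp.notMem_support_iff.1 hg],
      ENNReal.ofReal_sum_of_nonneg fun _ _ => sq_nonneg _]
    simp only [← ofReal_norm, ENNReal.ofReal_pow (norm_nonneg _)]
  rw [l2Norm, hsum, twoNorm, Real.sqrt_eq_rpow, ENNReal.ofReal_rpow_of_nonneg (by positivity)]
  norm_num

theorem enorm_ofReal_toReal {a : ℝ≥0∞} (ha : a ≠ ∞) : ‖(a.toReal : ℂ)‖ₑ = a := by
  rw [← ofReal_norm, Complex.norm_real, ofReal_norm, Real.enorm_toReal ha]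

theorem exists_coeff_eq_toReal {X : K → ℝ≥0∞} (hX : (Function.support X).Finite) :
    ∃ x : MonoidAlgebra ℂ K, ∀ g, x.coeff g = (X g).toReal :=
  ⟨MonoidAlgebra.ofCoeff (Finsupp.ofSupportFinite (fun g => ((X g).toReal : ℂ))
    (hX.subset fun g hg h0 => hg (by simp [h0]))), fun _ => rfl⟩

theorem exists_lp_eq_toReal {Y : K → ℝ≥0∞} (hY : l2Norm Y ≠ ∞) :
    ∃ ξ : lp (fun _ : K => ℂ) 2, ∀ g, ξ g = (Y g).toReal := by
  refine ⟨⟨fun g => ((Y g).toReal : ℂ), (memℓp_gen_iff (by norm_num)).2 ?_⟩, fun _ => rfl⟩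
  have hsq : ∑' g, Y g ^ 2 ≠ ∞ := l2Norm_sq Y ▸ ENNReal.pow_ne_top hY
  simpa using ENNReal.summable_toReal hsq

variable [Group K]

theorem regularRep_apply (x : MonoidAlgebra ℂ K) (ξ : lp (fun _ : K => ℂ) 2) (k : K) :
    regularRep x ξ k = ∑ g ∈ x.coeff.support, x.coeff g * ξ (g⁻¹ * k) := by
  have h : regularRep x ξ = ∑ g ∈ x.coeff.support, x.coeff g • leftTranslate g ξ := by
    simp [regularRep]
  rw [h, lp.coeFn_sum, Finset.sum_apply]
  rfl

theorem enorm_regularRep_apply_le (x : MonoidAlgebra ℂ K) (ξ : lp (fun _ : K => ℂ) 2) (k : K) :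
    ‖regularRep x ξ k‖ₑ ≤ groupConvolution (fun g => ‖x.coeff g‖ₑ) (fun g => ‖ξ g‖ₑ) k := by
  rw [regularRep_apply]
  refine (enorm_sum_le _ _).trans ?_
  simp only [enorm_mul]
  exact ENNReal.sum_le_tsum _

theorem hasDecay_of_convolutionBound {l : K → ℕ} {f : ℕ → ℝ} (hf : ∀ n, 0 ≤ f n)
    (h : ∀ n, ConvolutionBound {g | l g ≤ n} (ENNReal.ofReal (f n))) : HasDecay l f := by
  intro n x hx
  have hsupp : Function.support (fun g => ‖x.coeff g‖ₑ) = x.coeff.support := by ext; simp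
  refine ContinuousLinearMap.opNorm_le_bound _ (mul_nonneg (hf n) (twoNorm_nonneg x)) fun ξ => ?_
  rw [← ENNReal.ofReal_le_ofReal_iff (by have := hf n; have := twoNorm_nonneg x; positivity)]
  calc ENNReal.ofReal ‖regularRep x ξ‖ = l2Norm fun k => ‖regularRep x ξ k‖ₑ := by
        rw [ofReal_norm, l2Norm_enorm]
    _ ≤ l2Norm (groupConvolution (fun g => ‖x.coeff g‖ₑ) fun g => ‖ξ g‖ₑ) :=
        l2Norm_mono (enorm_regularRep_apply_le x ξ)
    _ ≤ ENNReal.ofReal (f n) * l2Norm (fun g => ‖x.coeff g‖ₑ) * l2Norm fun g => ‖ξ g‖ₑ := by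
        refine h n _ _ (hsupp ▸ Finset.finite_toSet _) (fun _ => enorm_ne_top) (hsupp ▸ hx) ?_
        rw [l2Norm_enorm]
        exact enorm_ne_top
    _ = ENNReal.ofReal (f n * twoNorm x * ‖ξ‖) := by
        rw [l2Norm_enorm_coeff, l2Norm_enorm, ENNReal.ofReal_mul' (norm_nonneg _),
          ENNReal.ofReal_mul' (twoNorm_nonneg _), ofReal_norm]

theorem HasDecay.nonneg {l : K → ℕ} {f : ℕ → ℝ} (hl : l 1 = 0) (h : HasDecay l f) (n : ℕ) :
    0 ≤ f n := by
  have hsupp : (MonoidAlgebra.single (1 : K) (1 : ℂ)).coeff.support = {1} := by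
    ext g; simp [eq_comm]
  have hnorm : twoNorm (MonoidAlgebra.single (1 : K) (1 : ℂ)) = 1 := by
    rw [twoNorm, hsupp]; simp
  have hone := h n (MonoidAlgebra.single 1 1) (by simp [hl])
  rw [hnorm, mul_one] at hone
  exact (norm_nonneg _).trans hone

theorem enorm_regularRep_apply_of_toReal {X Y : K → ℝ≥0∞} (hX : ∀ g, X g ≠ ∞) (hY : ∀ g, Y g ≠ ∞)
    {x : MonoidAlgebra ℂ K} (hx : ∀ g, x.coeff g = (X g).toReal)
    {ξ : lp (fun _ : K => ℂ) 2} (hξ : ∀ g, ξ g = (Y g).toReal) (c : K) :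
    ‖regularRep x ξ c‖ₑ = groupConvolution X Y c := by
  have hXY (g : K) : X g * Y (g⁻¹ * c) ≠ ∞ := ENNReal.mul_ne_top (hX _) (hY _)
  have hzero (g : K) (hg : g ∉ x.coeff.support) : X g * Y (g⁻¹ * c) = 0 := by
    have : X g = 0 := by simpa [hx, ENNReal.toReal_eq_zero_iff, hX g] using hg
    rw [this, zero_mul]
  calc ‖regularRep x ξ c‖ₑ = ‖((∑ g ∈ x.coeff.support, X g * Y (g⁻¹ * c)).toReal : ℂ)‖ₑ := by
        rw [regularRep_apply, ENNReal.toReal_sum fun g _ => hXY g]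
        simp [hx, hξ]
    _ = ∑ g ∈ x.coeff.support, X g * Y (g⁻¹ * c) := by
        exact enorm_ofReal_toReal (ENNReal.sum_ne_top.2 fun g _ => hXY g)
    _ = groupConvolution X Y c := (tsum_eq_sum hzero).symm

theorem HasDecay.convolutionBound {l : K → ℕ} {f : ℕ → ℝ} (h : HasDecay l f) (n : ℕ) :
    ConvolutionBound {g | l g ≤ n} (ENNReal.ofReal (f n)) := by
  intro X Y hX hX' hXn hY
  have hY' (g : K) : Y g ≠ ∞ := ne_top_of_le_ne_top hY (le_l2Norm Y g)
  obtain ⟨x, hx⟩ := exists_coeff_eq_toReal hX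
  obtain ⟨ξ, hξ⟩ := exists_lp_eq_toReal hY
  have hxn (g : K) (hg : g ∈ x.coeff.support) : l g ≤ n :=
    hXn fun h0 => Finsupp.mem_support_iff.1 hg (by simp [hx, h0])
  calc l2Norm (groupConvolution X Y) = ENNReal.ofReal ‖regularRep x ξ‖ := by
        rw [ofReal_norm, ← l2Norm_enorm]
        exact congrArg l2Norm
          (funext fun c => (enorm_regularRep_apply_of_toReal hX' hY' hx hξ c).symm)
    _ ≤ ENNReal.ofReal (f n * twoNorm x * ‖ξ‖) :=
        ENNReal.ofReal_le_ofReal ((regularRep x).le_of_opNorm_le (h n x hxn) ξ)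
    _ = ENNReal.ofReal (f n) * l2Norm (fun g => ‖x.coeff g‖ₑ) * l2Norm fun g => ‖ξ g‖ₑ := by
        rw [l2Norm_enorm_coeff, l2Norm_enorm, ENNReal.ofReal_mul' (norm_nonneg _),
          ENNReal.ofReal_mul' (twoNorm_nonneg _), ofReal_norm]
    _ = ENNReal.ofReal (f n) * l2Norm X * l2Norm Y := by
        simp only [hx, hξ, enorm_ofReal_toReal (hX' _), enorm_ofReal_toReal (hY' _)]

theorem HasDecay.mono {l : K → ℕ} {f f' : ℕ → ℝ} (h : HasDecay l f) (hf : ∀ n, f n ≤ f' n) :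
    HasDecay l f' := fun n x hx =>
  (h n x hx).trans (mul_le_mul_of_nonneg_right (hf n) (twoNorm_nonneg x))

theorem HasDecay.mono_length {l l' : K → ℕ} {f : ℕ → ℝ} (h : HasDecay l f)
    (hl : ∀ k, l k ≤ l' k) : HasDecay l' f := fun n x hx =>
  h n x fun g hg => (hl g).trans (hx g hg)

end Decay

/-! ## Alternating words -/

section Alternating

variable {Γ : Type*}

/-- The total length of an alternating word that begins with a letter of type `b`, the letters of
type `b` being measured by `l b`. -/
def altLength (l : Bool → Γ → ℕ) : Bool → List Γ → ℕ
  | _, [] => 0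
  | b, g :: W => l b g + altLength l (!b) W

variable [Group Γ]

/-- The letters of the list lie alternately in `S b \ A` and `S (!b) \ A`, beginning with `S b`:
the normal forms of an amalgamated free product, without their last letter from `A`. -/
def IsAlternating (A : Subgroup Γ) (S : Bool → Subgroup Γ) : Bool → List Γ → Prop
  | _, [] => True
  | b, g :: W => g ∈ S b ∧ g ∉ A ∧ IsAlternating A S (!b) W

/-- The group is the amalgamated free product of its subgroups `S false` and `S true` over `A`,
characterized internally by the normal form theorem. -/
structure IsAmalgamPair (A : Subgroup Γ) (S : Bool → Subgroup Γ) : Prop where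
  le : ∀ b, A ≤ S b
  prod_notMem : ∀ b W, IsAlternating A S b W → W ≠ [] → W.prod ∉ A
  iSup_eq_top : ⨆ b, S b = ⊤

variable {A : Subgroup Γ} {S : Bool → Subgroup Γ} {b b' : Bool} {g g' a : Γ} {V W W' Z : List Γ}

theorem IsAlternating.append {W₁ W₂ : List Γ} (l : Bool → Γ → ℕ)
    (h : IsAlternating A S b (W₁ ++ W₂)) :
    IsAlternating A S b W₁ ∧ ∃ b', IsAlternating A S b' W₂ ∧
      altLength l b (W₁ ++ W₂) = altLength l b W₁ + altLength l b' W₂ := by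
  induction W₁ generalizing b with
  | nil => exact ⟨trivial, b, h, (zero_add _).symm⟩
  | cons g W ih =>
    obtain ⟨hgS, hgA, hW⟩ := h
    obtain ⟨hW₁, b', hW₂, hlen⟩ := ih hW
    exact ⟨⟨hgS, hgA, hW₁⟩, b', hW₂, by simp only [List.cons_append, altLength, hlen, add_assoc]⟩

theorem IsAlternating.exists_inv_append (l : Bool → Γ → ℕ) (hl : ∀ b, ∀ g ∈ S b, l b g⁻¹ = l b g)
    (hW : IsAlternating A S b W) (hV : IsAlternating A S (!b) V) :
    ∃ b', IsAlternating A S b' ((W.map (·⁻¹)).reverse ++ V) ∧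
      altLength l b' ((W.map (·⁻¹)).reverse ++ V) = altLength l b W + altLength l (!b) V := by
  induction W generalizing b V with
  | nil => exact ⟨!b, hV, (zero_add _).symm⟩
  | cons g W ih =>
    obtain ⟨hgS, hgA, hW⟩ := hW
    obtain ⟨b', halt, hlen⟩ := ih (V := g⁻¹ :: V) hW
      ⟨by simpa using hgS, by simpa using hgA, by simpa using hV⟩
    refine ⟨b', by simpa using halt, ?_⟩
    simp only [List.map_cons, List.reverse_cons, List.append_assoc, List.cons_append,
      List.nil_append, hlen, altLength, Bool.not_not, hl b g hgS]
    omega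

theorem IsAmalgamPair.cons_mul (hA : IsAmalgamPair A S) (ha : a ∈ A)
    (h : IsAlternating A S b (g :: W)) : IsAlternating A S b (a * g :: W) :=
  ⟨(S b).mul_mem (hA.le b ha) h.1, fun h' => h.2.1 ((A.mul_mem_cancel_left ha).1 h'), h.2.2⟩

theorem IsAmalgamPair.exists_alternating_smul (hA : IsAmalgamPair A S) (ha : a ∈ A)
    (hZ : IsAlternating A S b Z) :
    ∃ Z', IsAlternating A S b Z' ∧ (Z'.prod : Γ ⧸ A) = (a * Z.prod : Γ) ∧
      ∀ k, ((Z'.take k).prod : Γ ⧸ A) = (a * (Z.take k).prod : Γ) := by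
  have mk_a : ((1 : Γ) : Γ ⧸ A) = a := QuotientGroup.eq.2 (by simpa using ha)
  cases Z with
  | nil => exact ⟨[], trivial, by simpa using mk_a, by simpa using mk_a⟩
  | cons g V =>
    refine ⟨a * g :: V, hA.cons_mul ha hZ, by simp [mul_assoc], fun k => ?_⟩
    cases k with
    | zero => simpa using mk_a
    | succ k => simp [mul_assoc]

theorem IsAmalgamPair.inv_mul_notMem (hA : IsAmalgamPair A S) (hW : IsAlternating A S b W)
    (hV : IsAlternating A S (!b) V) (hne : W ≠ [] ∨ V ≠ []) : W.prod⁻¹ * V.prod ∉ A := by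
  obtain ⟨b', h, -⟩ := hW.exists_inv_append (fun _ _ => 0) (fun _ _ _ => rfl) hV
  rw [List.prod_inv_reverse, ← List.prod_append]
  exact hA.prod_notMem b' _ h (by simpa [imp_iff_not_or] using hne)

theorem IsAmalgamPair.head_eq (hA : IsAmalgamPair A S) (hW : IsAlternating A S b (g :: W))
    (hW' : IsAlternating A S b' (g' :: W')) (ha : a ∈ A)
    (h : ((g :: W).prod : Γ ⧸ A) = (a * (g' :: W').prod : Γ)) :
    b = b' ∧ g⁻¹ * a * g' ∈ A := by
  rw [QuotientGroup.eq] at h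
  have haW' := hA.cons_mul ha hW'
  obtain rfl | rfl := b'.eq_or_eq_not b
  · refine ⟨rfl, by_contra fun hg => ?_⟩
    have hV : IsAlternating A S (!!b') (g⁻¹ * a * g' :: W') :=
      ⟨by simpa [mul_assoc] using (S b').mul_mem ((S b').inv_mem hW.1) haW'.1, hg,
        by simpa using hW'.2.2⟩
    refine hA.inv_mul_notMem hW.2.2 hV (by simp) ?_
    simpa only [List.prod_cons, mul_inv_rev, mul_assoc] using h
  · refine absurd ?_ (hA.inv_mul_notMem hW haW' (by simp))
    simpa only [List.prod_cons, mul_assoc] using h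

theorem IsAmalgamPair.normalForm_unique (hA : IsAmalgamPair A S) (hW : IsAlternating A S b W)
    (hW' : IsAlternating A S b' W') (ha : a ∈ A) (h : (W.prod : Γ ⧸ A) = (a * W'.prod : Γ)) :
    W.length = W'.length ∧ (W ≠ [] → b = b') ∧
      ∀ k, ((W.take k).prod : Γ ⧸ A) = (a * (W'.take k).prod : Γ) := by
  have mk_a : ((1 : Γ) : Γ ⧸ A) = a := QuotientGroup.eq.2 (by simpa using ha)
  induction W generalizing b b' W' a with
  | nil =>
    cases W' with
    | nil => simpa using mk_a
    | cons g' V' =>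
      rw [QuotientGroup.eq, List.prod_nil, inv_one, one_mul, A.mul_mem_cancel_left ha] at h
      exact absurd h (hA.prod_notMem b' _ hW' (by simp))
  | cons g V ih =>
    cases W' with
    | nil =>
      rw [List.prod_nil, mul_one, ← mk_a, eq_comm, QuotientGroup.eq, inv_one, one_mul] at h
      exact absurd h (hA.prod_notMem b _ hW (by simp))
    | cons g' V' =>
      obtain ⟨rfl, hg⟩ := hA.head_eq hW hW' ha h
      have hV : (V.prod : Γ ⧸ A) = (g⁻¹ * a * g' * V'.prod : Γ) := by
        rw [QuotientGroup.eq] at h ⊢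
        simpa only [List.prod_cons, mul_inv_rev, mul_assoc] using h
      obtain ⟨hlen, -, htake⟩ := ih hW.2.2 hW'.2.2 hg hV (QuotientGroup.eq.2 (by simpa using hg))
      refine ⟨by simp [hlen], fun _ => rfl, fun k => ?_⟩
      cases k with
      | zero => simpa using mk_a
      | succ k =>
        have := QuotientGroup.eq.1 (htake k)
        rw [QuotientGroup.eq]
        simpa only [List.take_succ_cons, List.prod_cons, mul_inv_rev, mul_assoc] using this

theorem IsAmalgamPair.exists_alternating_mul (hA : IsAmalgamPair A S) (hg : g ∈ S b)
    (hZ : IsAlternating A S b' Z) :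
    ∃ b'' Z'', IsAlternating A S b'' Z'' ∧ (Z''.prod : Γ ⧸ A) = (g * Z.prod : Γ) := by
  have smul {b} {Z} {a} (ha : a ∈ A) (hZ : IsAlternating A S b Z) :
      ∃ b'' Z'', IsAlternating A S b'' Z'' ∧ (Z''.prod : Γ ⧸ A) = (a * Z.prod : Γ) := by
    obtain ⟨Z'', hZ'', hprod, -⟩ := hA.exists_alternating_smul ha hZ
    exact ⟨b, Z'', hZ'', hprod⟩
  by_cases hgA : g ∈ A
  · exact smul hgA hZ
  obtain rfl | rfl := b'.eq_or_eq_not b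
  · cases Z with
    | nil => exact ⟨b', [g], ⟨hg, hgA, trivial⟩, by simp⟩
    | cons k V =>
      rw [List.prod_cons, ← mul_assoc]
      by_cases hgk : g * k ∈ A
      · exact smul hgk hZ.2.2
      · exact ⟨b', g * k :: V, ⟨(S b').mul_mem hg hZ.1, hgk, hZ.2.2⟩, by simp⟩
  · exact ⟨b, g :: Z, ⟨hg, hgA, hZ⟩, by simp⟩

theorem IsAmalgamPair.exists_alternating (hA : IsAmalgamPair A S) (x : Γ ⧸ A) :
    ∃ b Z, IsAlternating A S b Z ∧ (Z.prod : Γ ⧸ A) = x := by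
  obtain ⟨z, rfl⟩ := QuotientGroup.mk_surjective x
  have hz : z ∈ Subgroup.closure (⋃ b, (S b : Set Γ)) := by
    rw [← Subgroup.iSup_eq_closure, hA.iSup_eq_top]
    exact Subgroup.mem_top z
  have mul {b g z} (hg : g ∈ S b)
      (hz : ∃ b Z, IsAlternating A S b Z ∧ (Z.prod : Γ ⧸ A) = (z : Γ)) :
      ∃ b Z, IsAlternating A S b Z ∧ (Z.prod : Γ ⧸ A) = (g * z : Γ) := by
    obtain ⟨b', Z, hZ, hZz⟩ := hz
    obtain ⟨b'', Z'', hZ'', h⟩ := hA.exists_alternating_mul hg hZ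
    exact ⟨b'', Z'', hZ'', h.trans (congrArg (g • ·) hZz)⟩
  induction hz using Subgroup.closure_induction_left with
  | one => exact ⟨false, [], trivial, rfl⟩
  | mul_left g hg z _ ih =>
    obtain ⟨b, hg⟩ := Set.mem_iUnion.1 hg
    exact mul hg ih
  | inv_mul_cancel g hg z _ ih =>
    obtain ⟨b, hg⟩ := Set.mem_iUnion.1 hg
    exact mul ((S b).inv_mem hg) ih

end Alternating

/-! ## Prefixes and minimal representatives -/

section Prefixes

variable {Γ : Type*} [Group Γ] {A : Subgroup Γ} {S : Bool → Subgroup Γ}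

/-- The first `k` letters in a normal form of the coset `x` represent the coset `q`. -/
def IsPrefixCoset (A : Subgroup Γ) (S : Bool → Subgroup Γ) (k : ℕ) (x q : Γ ⧸ A) : Prop :=
  ∃ b Z, IsAlternating A S b Z ∧ (Z.prod : Γ ⧸ A) = x ∧ ((Z.take k).prod : Γ ⧸ A) = q

/-- The coset represented by the first `k` letters in a normal form of the coset `x`. -/
noncomputable def prefixCoset (A : Subgroup Γ) (S : Bool → Subgroup Γ) (k : ℕ) (x : Γ ⧸ A) :
    Γ ⧸ A :=
  Classical.epsilon (IsPrefixCoset A S k x)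

variable {b b' : Bool} {V W Z : List Γ}

theorem IsPrefixCoset.prefixCoset_eq (hA : IsAmalgamPair A S) {k : ℕ} {x q : Γ ⧸ A}
    (h : IsPrefixCoset A S k x q) : prefixCoset A S k x = q := by
  obtain ⟨b, Z, hZ, hZx, hZk⟩ := h
  obtain ⟨b', Z', hZ', hZ'x, hZ'k⟩ : IsPrefixCoset A S k x (prefixCoset A S k x) :=
    Classical.epsilon_spec ⟨q, b, Z, hZ, hZx, hZk⟩
  rw [← hZk, ← hZ'k]
  simpa using (hA.normalForm_unique hZ' hZ A.one_mem (by simp [hZx, hZ'x])).2.2 k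

theorem IsAmalgamPair.prefixCoset_zero (hA : IsAmalgamPair A S) (x : Γ ⧸ A) :
    prefixCoset A S 0 x = (1 : Γ) := by
  obtain ⟨b, Z, hZ, hZx⟩ := hA.exists_alternating x
  exact IsPrefixCoset.prefixCoset_eq hA ⟨b, Z, hZ, hZx, by simp⟩

theorem IsAmalgamPair.prefixCoset_append (hA : IsAmalgamPair A S)
    (hW : IsAlternating A S b (W ++ V)) :
    prefixCoset A S W.length ((W ++ V).prod : Γ) = (W.prod : Γ) :=
  IsPrefixCoset.prefixCoset_eq hA ⟨b, W ++ V, hW, rfl, by rw [List.take_left]⟩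

theorem IsAmalgamPair.prefixCoset_inv_mul (hA : IsAmalgamPair A S) (hW : IsAlternating A S b W)
    (hV : IsAlternating A S (!b) V) :
    prefixCoset A S W.length (W.prod⁻¹ * V.prod : Γ) = (W.prod⁻¹ : Γ) := by
  obtain ⟨b', h, -⟩ := hW.exists_inv_append (fun _ _ => 0) (fun _ _ _ => rfl) hV
  simpa [List.prod_inv_reverse] using hA.prefixCoset_append h

theorem IsAmalgamPair.prefixCoset_append_inv (hA : IsAmalgamPair A S)
    (hW : IsAlternating A S b (W ++ V)) :
    prefixCoset A S V.length ((W ++ V).prod⁻¹ : Γ) = (V.prod⁻¹ : Γ) := by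
  obtain ⟨b', h, -⟩ := hW.exists_inv_append (V := []) (fun _ _ => 0) (fun _ _ _ => rfl) trivial
  rw [List.append_nil, List.map_append, List.reverse_append] at h
  simpa [List.prod_inv_reverse] using hA.prefixCoset_append h

theorem IsAmalgamPair.exists_divergence_of_same_type (hA : IsAmalgamPair A S)
    (hW : IsAlternating A S b W) (hZ : IsAlternating A S b Z) :
    ∃ W₁ M W₂, W = W₁ ++ M ++ W₂ ∧ M.length ≤ 1 ∧
      ((Z.take W₁.length).prod : Γ ⧸ A) = (W₁.prod : Γ) ∧
      prefixCoset A S W₂.length (W.prod⁻¹ * Z.prod : Γ) = (W₂.prod⁻¹ : Γ) := by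
  induction W generalizing b Z with
  | nil => exact ⟨[], [], [], rfl, by simp, rfl, by simpa using hA.prefixCoset_zero _⟩
  | cons g W ih =>
    cases Z with
    | nil => exact ⟨[], [], g :: W, rfl, by simp, rfl, hA.prefixCoset_inv_mul hW trivial⟩
    | cons g' Z =>
      by_cases hg : g⁻¹ * g' ∈ A
      · obtain ⟨Z', hZ', hprod, htake⟩ := hA.exists_alternating_smul hg hZ.2.2
        obtain ⟨W₁, M, W₂, rfl, hM, hW₁, hW₂⟩ := ih hW.2.2 hZ'
        refine ⟨g :: W₁, M, W₂, rfl, hM, ?_, ?_⟩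
        · rw [htake, QuotientGroup.eq] at hW₁
          rw [QuotientGroup.eq]
          simpa [mul_assoc] using hW₁
        · rw [← hW₂]
          congr 1
          rw [QuotientGroup.eq] at hprod ⊢
          simpa [mul_assoc] using A.inv_mem hprod
      · refine ⟨[], [g], W, rfl, by simp, rfl, ?_⟩
        have hV : IsAlternating A S (!!b) (g⁻¹ * g' :: Z) :=
          ⟨by simpa using (S b).mul_mem ((S b).inv_mem hW.1) hZ.1, hg, by simpa using hZ.2.2⟩
        simpa only [List.prod_cons, mul_inv_rev, mul_assoc] using
          hA.prefixCoset_inv_mul hW.2.2 hV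

theorem IsAmalgamPair.exists_divergence (hA : IsAmalgamPair A S) (hW : IsAlternating A S b W)
    (z : Γ) :
    ∃ W₁ M W₂, W = W₁ ++ M ++ W₂ ∧ M.length ≤ 1 ∧
      prefixCoset A S W₁.length z = (W₁.prod : Γ) ∧
      prefixCoset A S W₂.length (W.prod⁻¹ * z : Γ) = (W₂.prod⁻¹ : Γ) := by
  obtain ⟨b', Z, hZ, hZz⟩ := hA.exists_alternating (z : Γ ⧸ A)
  have hWz : ((W.prod⁻¹ * Z.prod : Γ) : Γ ⧸ A) = (W.prod⁻¹ * z : Γ) :=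
    congrArg (W.prod⁻¹ • ·) hZz
  obtain rfl | rfl := b'.eq_or_eq_not b
  · obtain ⟨W₁, M, W₂, hWM, hM, hW₁, hW₂⟩ := hA.exists_divergence_of_same_type hW hZ
    exact ⟨W₁, M, W₂, hWM, hM, IsPrefixCoset.prefixCoset_eq hA ⟨b', Z, hZ, hZz, hW₁⟩, hWz ▸ hW₂⟩
  · exact ⟨[], [], W, rfl, by simp, hA.prefixCoset_zero _, hWz ▸ hA.prefixCoset_inv_mul hW hZ⟩

/-- The element `m` represents the coset `q` by an alternating word of minimal length. -/
def IsMinimalRep (A : Subgroup Γ) (S : Bool → Subgroup Γ) (l : Bool → Γ → ℕ) (q : Γ ⧸ A)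
    (m : Γ) : Prop :=
  ∃ b V, IsAlternating A S b V ∧ V.prod = m ∧ (m : Γ ⧸ A) = q ∧
    ∀ b' W, IsAlternating A S b' W → (W.prod : Γ ⧸ A) = q → altLength l b V ≤ altLength l b' W

theorem IsAmalgamPair.exists_isMinimalRep (hA : IsAmalgamPair A S) (l : Bool → Γ → ℕ)
    (q : Γ ⧸ A) : ∃ m, IsMinimalRep A S l q m := by
  classical
  have hex : ∃ n b V, IsAlternating A S b V ∧ (V.prod : Γ ⧸ A) = q ∧ altLength l b V = n := by
    obtain ⟨b, Z, hZ, hZq⟩ := hA.exists_alternating q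
    exact ⟨_, b, Z, hZ, hZq, rfl⟩
  obtain ⟨b, V, hV, hVq, hlen⟩ := Nat.find_spec hex
  exact ⟨V.prod, b, V, hV, rfl, hVq, fun b' W hW hWq =>
    hlen.trans_le (Nat.find_min' hex ⟨b', W, hW, hWq, rfl⟩)⟩

theorem IsMinimalRep.eq_one (hA : IsAmalgamPair A S) {l : Bool → Γ → ℕ} {m : Γ}
    (h : IsMinimalRep A S l (1 : Γ) m) : m = 1 := by
  obtain ⟨b, V, hV, rfl, hV1, -⟩ := h
  have hVA : V.prod ∈ A := by simpa using QuotientGroup.eq.1 hV1.symm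
  obtain rfl : V = [] := by_contra fun hne => hA.prod_notMem b V hV hne hVA
  rfl

end Prefixes

/-! ## Lengths and short forms -/

section Lengths

variable {Γ : Type*} [Group Γ]

/-- Length functions on the two subgroups `S b`, for which the elements of length zero lie in `A`
and have length zero in both subgroups. -/
structure IsLengthPair (A : Subgroup Γ) (S : Bool → Subgroup Γ) (l : Bool → Γ → ℕ) : Prop where
  one : ∀ b, l b 1 = 0
  inv : ∀ b, ∀ g ∈ S b, l b g⁻¹ = l b g
  mul_le : ∀ b, ∀ g ∈ S b, ∀ h ∈ S b, l b (g * h) ≤ l b g + l b h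
  zero : ∀ b, ∀ g ∈ S b, l b g = 0 → g ∈ A ∧ l (!b) g = 0

/-- Passing from one length to the other increases the lengths of elements of `A` at most by
a factor `1 + c`, or by `c * n` where the length is less than `n`. -/
def ConversionBound (A : Subgroup Γ) (l : Bool → Γ → ℕ) (n : ℕ) (c : ℝ) : Prop :=
  ∀ b, ∀ a ∈ A, (l (!b) a : ℝ) ≤ l b a + c * max (l b a : ℝ) n

/-- The excess length allowed after `t` conversions, in words of total length at most `D`: each
conversion multiplies the length by at most `1 + c`. -/
noncomputable def conversionExcess (D c : ℝ) (t : ℕ) : ℝ := D * ((1 + c) ^ t - 1)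

variable {A : Subgroup Γ} {S : Bool → Subgroup Γ} {l : Bool → Γ → ℕ} {n s t : ℕ} {c D : ℝ}
  {b : Bool} {g a u m : Γ} {V W W' : List Γ}

theorem conversionExcess_zero : conversionExcess D c 0 = 0 := by simp [conversionExcess]

theorem add_conversionExcess (t : ℕ) : D + conversionExcess D c t = D * (1 + c) ^ t := by
  unfold conversionExcess; ring

theorem conversionExcess_succ (t : ℕ) :
    conversionExcess D c (t + 1) = conversionExcess D c t + c * (D * (1 + c) ^ t) := by
  unfold conversionExcess; ring

theorem conversionExcess_mono (hD : 0 ≤ D) (hc : 0 ≤ c) : Monotone (conversionExcess D c) :=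
  fun t t' h => by
    have : (1 + c) ^ t ≤ (1 + c) ^ t' := pow_le_pow_right₀ (by linarith) h
    unfold conversionExcess
    gcongr

theorem conversionExcess_add_le (hD : 0 ≤ D) (hc : 0 ≤ c) (t t' : ℕ) :
    conversionExcess D c t + conversionExcess D c t' ≤ conversionExcess D c (t + t') := by
  have ht : 0 ≤ (1 + c) ^ t - 1 := sub_nonneg.2 (one_le_pow₀ (by linarith))
  have ht' : 0 ≤ (1 + c) ^ t' - 1 := sub_nonneg.2 (one_le_pow₀ (by linarith))
  unfold conversionExcess
  rw [pow_add]
  nlinarith [mul_nonneg hD (mul_nonneg ht ht')]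

theorem conversionExcess_add_mul_le (hD : 0 ≤ D) (hc : 0 ≤ c) (t : ℕ) :
    conversionExcess D c t + c * D ≤ conversionExcess D c (t + 1) := by
  have : D ≤ D * (1 + c) ^ t := le_mul_of_one_le_right hD (one_le_pow₀ (by linarith))
  rw [conversionExcess_succ]
  gcongr

theorem ConversionBound.convert (hcv : ConversionBound A l n c) (hc : 0 ≤ c) (hn : (n : ℝ) ≤ D)
    (ha : a ∈ A) {r : ℝ} (hr : r ≤ D) (hx : (l b a : ℝ) ≤ r + conversionExcess D c t)
    (b' : Bool) : (l b' a : ℝ) ≤ r + conversionExcess D c (t + 1) := by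
  have hD : 0 ≤ D := n.cast_nonneg.trans hn
  obtain rfl | rfl := b'.eq_or_eq_not b
  · exact hx.trans (by gcongr; exact conversionExcess_mono hD hc (Nat.le_succ t))
  · have hmax : max (l b a : ℝ) n ≤ D * (1 + c) ^ t :=
      max_le (by linarith [add_conversionExcess (D := D) (c := c) t])
        (hn.trans (le_mul_of_one_le_right hD (one_le_pow₀ (by linarith))))
    have := mul_le_mul_of_nonneg_left hmax hc
    rw [conversionExcess_succ]
    linarith [hcv b a ha]

theorem IsLengthPair.length_inv_mul_le (hl : IsLengthPair A S l) (hA : IsAmalgamPair A S)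
    (hcv : ConversionBound A l n c) (hc : 0 ≤ c) (hn : (n : ℝ) ≤ D) {r : ℝ}
    (hW : IsAlternating A S b W) (hW' : IsAlternating A S b W') (ha : a ∈ A)
    (h : (W.prod : Γ ⧸ A) = (a * W'.prod : Γ)) (hr : r + altLength l b W + altLength l b W' ≤ D)
    (har : ∀ b', (l b' a : ℝ) ≤ r + conversionExcess D c t) (b' : Bool) :
    (l b' (W.prod⁻¹ * a * W'.prod) : ℝ) ≤
      r + altLength l b W + altLength l b W' + conversionExcess D c (t + W.length) := by
  have hlen := (hA.normalForm_unique hW hW' ha h).1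
  induction W generalizing b W' a r t with
  | nil =>
    obtain rfl := List.eq_nil_of_length_eq_zero hlen.symm
    simpa [altLength] using har b'
  | cons g V ih =>
    cases W' with
    | nil => simp at hlen
    | cons g' V' =>
      have hg := (hA.head_eq hW hW' ha h).2
      have hV : (V.prod : Γ ⧸ A) = (g⁻¹ * a * g' * V'.prod : Γ) := by
        rw [QuotientGroup.eq] at h ⊢
        simpa only [List.prod_cons, mul_inv_rev, mul_assoc] using h
      have hprod : (g :: V).prod⁻¹ * a * (g' :: V').prod = V.prod⁻¹ * (g⁻¹ * a * g') * V'.prod := by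
        simp only [List.prod_cons, mul_inv_rev, mul_assoc]
      have hle : l b (g⁻¹ * a * g') ≤ l b g + l b a + l b g' := by
        have hga := (S b).mul_mem ((S b).inv_mem hW.1) (hA.le b ha)
        have h₁ := hl.mul_le b _ hga _ hW'.1
        have h₂ := hl.mul_le b _ ((S b).inv_mem hW.1) _ (hA.le b ha)
        rw [hl.inv b g hW.1] at h₂
        omega
      have hle' : (l b (g⁻¹ * a * g') : ℝ) ≤ r + l b g + l b g' + conversionExcess D c t :=
        (Nat.cast_le.2 hle).trans (by push_cast; linarith only [har b])
      simp only [altLength, Nat.cast_add] at hr ⊢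
      have hV0 : (0 : ℝ) ≤ altLength l (!b) V := Nat.cast_nonneg _
      have hV'0 : (0 : ℝ) ≤ altLength l (!b) V' := Nat.cast_nonneg _
      have hconv := hcv.convert hc hn hg (r := r + l b g + l b g') (t := t)
        (by linarith only [hr, hV0, hV'0]) hle'
      have hih := ih hW.2.2 hW'.2.2 hg hV (by linarith only [hr]) hconv (by simpa using hlen)
      rw [hprod, List.length_cons, show t + (V.length + 1) = t + 1 + V.length by omega]
      exact hih.trans_eq (by ring)

theorem IsMinimalRep.length_inv_mul_le (hl : IsLengthPair A S l) (hA : IsAmalgamPair A S)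
    (hcv : ConversionBound A l n c) (hc : 0 ≤ c) (hn : (n : ℝ) ≤ D)
    (hm : IsMinimalRep A S l (W.prod : Γ) m) (hW : IsAlternating A S b W)
    (hD : 2 * (altLength l b W : ℝ) ≤ D) :
    W.prod⁻¹ * m ∈ A ∧ ∀ b', (l b' (W.prod⁻¹ * m) : ℝ) ≤
      2 * altLength l b W + conversionExcess D c W.length := by
  obtain ⟨b₁, V, hV, rfl, hVW, hmin⟩ := hm
  refine ⟨QuotientGroup.eq.1 hVW.symm, fun b' => ?_⟩
  have h : (W.prod : Γ ⧸ A) = (1 * V.prod : Γ) := by rw [one_mul, hVW]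
  have hle : altLength l b₁ V ≤ altLength l b W := hmin b W hW rfl
  rify at hle
  obtain ⟨hlen, htype, -⟩ := hA.normalForm_unique hW hV A.one_mem h
  by_cases hne : W = []
  · subst hne
    obtain rfl := List.eq_nil_of_length_eq_zero hlen.symm
    simp [hl.one, altLength, conversionExcess_zero]
  · obtain rfl := htype hne
    have := hl.length_inv_mul_le hA hcv hc hn (r := 0) (t := 0) hW hV A.one_mem h (by linarith)
      (fun b'' => by simp [hl.one, conversionExcess_zero]) b'
    rw [mul_one, zero_add (List.length W)] at this
    linarith

theorem IsMinimalRep.length_mul_le (hl : IsLengthPair A S l) (hA : IsAmalgamPair A S)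
    (hcv : ConversionBound A l n c) (hc : 0 ≤ c) (hn : (n : ℝ) ≤ D)
    (hm : IsMinimalRep A S l (W.prod⁻¹ : Γ) m) (hW : IsAlternating A S b W)
    (hD : 2 * (altLength l b W : ℝ) ≤ D) :
    W.prod * m ∈ A ∧ ∀ b', (l b' (W.prod * m) : ℝ) ≤
      2 * altLength l b W + conversionExcess D c W.length := by
  obtain ⟨b', hW', hlen⟩ := hW.exists_inv_append l hl.inv (V := []) trivial
  rw [List.append_nil] at hW' hlen
  simp only [altLength, add_zero] at hlen
  rw [List.prod_inv_reverse] at hm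
  have := hm.length_inv_mul_le hl hA hcv hc hn hW' (by rwa [hlen])
  simpa only [← List.prod_inv_reverse, inv_inv, hlen, List.length_reverse, List.length_map] using
    this

/-- The form of the elements of word length at most `s`: either a short element of `A`, or
a short alternating word obtained after `t` conversions, each of which has used up one unit of
the word length, as has each letter. -/
def HasShortForm (A : Subgroup Γ) (S : Bool → Subgroup Γ) (l : Bool → Γ → ℕ) (n : ℕ) (c : ℝ)
    (s : ℕ) (u : Γ) : Prop :=
  (u ∈ A ∧ ∀ b, (l b u : ℝ) ≤ s + conversionExcess n c s) ∨
    ∃ b g V t, IsAlternating A S b (g :: V) ∧ t + V.length < s ∧ (g :: V).prod = u ∧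
      (altLength l b (g :: V) : ℝ) ≤ s + conversionExcess n c t

theorem IsLengthPair.hasShortForm_one (hl : IsLengthPair A S l) : HasShortForm A S l n c 0 1 :=
  Or.inl ⟨A.one_mem, fun b => by simp [hl.one, conversionExcess_zero]⟩

theorem HasShortForm.of_amalgam_mul (hl : IsLengthPair A S l) (hA : IsAmalgamPair A S)
    (hc : 0 ≤ c) (ha : a ∈ A) (hV : IsAlternating A S b V) (ht : t + V.length ≤ s)
    (h : ∀ b', (l b' a + altLength l b V : ℝ) ≤ s + conversionExcess n c t) :
    HasShortForm A S l n c s (a * V.prod) := by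
  cases V with
  | nil =>
    refine Or.inl ⟨by simpa using ha, fun b' => ?_⟩
    have := conversionExcess_mono n.cast_nonneg hc (show t ≤ s by simpa using ht)
    have := h b'
    simp only [altLength, Nat.cast_zero, add_zero, List.prod_nil, mul_one] at this ⊢
    linarith
  | cons k V =>
    refine Or.inr ⟨b, a * k, V, t, hA.cons_mul ha hV,
      by simp only [List.length_cons] at ht; omega, by simp [mul_assoc], le_trans ?_ (h b)⟩
    have := hl.mul_le b a (hA.le b ha) k hV.1
    simp only [altLength]
    norm_cast
    omega

theorem IsLengthPair.length_add_conversionExcess_le (hl : IsLengthPair A S l)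
    (hA : IsAmalgamPair A S) (hcv : ConversionBound A l n c) (hc : 0 ≤ c) (ha : a ∈ A)
    (hn : l b a ≤ n) (b' : Bool) :
    l b' a + conversionExcess n c t ≤ l b a + conversionExcess n c (t + l b a) := by
  have hmono := conversionExcess_mono (D := n) n.cast_nonneg hc
  obtain rfl | rfl := b'.eq_or_eq_not b
  · gcongr
    exact hmono (Nat.le_add_right _ _)
  rcases Nat.eq_zero_or_pos (l b a) with h0 | hpos
  · simp [h0, (hl.zero b a (hA.le b ha) h0).2]
  · have hconv := hcv b a ha
    rw [max_eq_right (by exact_mod_cast hn)] at hconv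
    linarith [conversionExcess_add_mul_le (D := n) n.cast_nonneg hc t,
      hmono (show t + 1 ≤ t + l b a by omega)]

theorem HasShortForm.mul_amalgam (hl : IsLengthPair A S l) (hA : IsAmalgamPair A S)
    (hcv : ConversionBound A l n c) (hc : 0 ≤ c) (hu : HasShortForm A S l n c s u) (ha : a ∈ A)
    (hs : l b a + s ≤ n) : HasShortForm A S l n c (l b a + s) (a * u) := by
  have hconv := fun t => hl.length_add_conversionExcess_le hA hcv hc ha (t := t)
    (show l b a ≤ n by omega)
  rcases hu with ⟨hu, h⟩ | ⟨b₁, k, V, t, hW, hlen, rfl, h⟩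
  · rw [← mul_one (a * u)]
    refine .of_amalgam_mul (V := []) (b := b) hl hA hc (A.mul_mem ha hu) trivial
      (t := s + l b a) (by simp only [List.length_nil]; omega) fun b' => ?_
    have hmul := hl.mul_le b' a (hA.le b' ha) u (hA.le b' hu)
    rify at hmul
    simp only [altLength, Nat.cast_zero, Nat.cast_add]
    linarith [h b', hconv s b']
  · refine .of_amalgam_mul hl hA hc ha hW (t := t + l b a)
      (by simp only [List.length_cons]; omega) fun b' => ?_
    push_cast
    linarith [hconv t b']

theorem HasShortForm.mul_letter (hl : IsLengthPair A S l) (hA : IsAmalgamPair A S)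
    (hcv : ConversionBound A l n c) (hc : 0 ≤ c) (hu : HasShortForm A S l n c s u) (hg : g ∈ S b)
    (hgA : g ∉ A) (hs : l b g + s ≤ n) : HasShortForm A S l n c (l b g + s) (g * u) := by
  have hpos : 0 < l b g := Nat.pos_of_ne_zero fun h => hgA (hl.zero b g hg h).1
  have hmul : ∀ k ∈ S b, (l b (g * k) : ℝ) ≤ l b g + l b k := fun k hk =>
    mod_cast hl.mul_le b g hg k hk
  rcases hu with ⟨hu, h⟩ | ⟨b', k, V, t, hW, hlen, rfl, h⟩
  · refine Or.inr ⟨b, g * u, [], s, ⟨(S b).mul_mem hg (hA.le b hu),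
      fun h' => hgA ((A.mul_mem_cancel_right hu).1 h'), trivial⟩, by simpa using hpos, by simp, ?_⟩
    simp only [altLength, Nat.cast_add, Nat.cast_zero]
    linarith [h b, hmul u (hA.le b hu)]
  simp only [altLength, Nat.cast_add] at h
  obtain rfl | rfl := b'.eq_or_eq_not b
  · have hgk := hmul k hW.1
    rw [List.prod_cons, ← mul_assoc]
    by_cases hgkA : g * k ∈ A
    · refine .of_amalgam_mul hl hA hc hgkA hW.2.2 (t := t + 1) (by omega) fun b'' => ?_
      have : (0 : ℝ) ≤ altLength l (!b') V := Nat.cast_nonneg _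
      rify at hs
      have := hcv.convert hc le_rfl hgkA (r := l b' g + s - altLength l (!b') V) (t := t)
        (by linarith) (by linarith) b''
      push_cast
      linarith
    · refine Or.inr ⟨b', g * k, V, t, ⟨(S b').mul_mem hg hW.1, hgkA, hW.2.2⟩, by omega, by simp, ?_⟩
      simp only [altLength, Nat.cast_add]
      linarith
  · refine Or.inr ⟨b, g, k :: V, t, ⟨hg, hgA, hW⟩,
      by simp only [List.length_cons]; omega, by simp, ?_⟩
    simp only [altLength, Nat.cast_add]
    linarith

theorem HasShortForm.mul (hl : IsLengthPair A S l) (hA : IsAmalgamPair A S)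
    (hcv : ConversionBound A l n c) (hc : 0 ≤ c) (hu : HasShortForm A S l n c s u) (hg : g ∈ S b)
    (hs : l b g + s ≤ n) : HasShortForm A S l n c (l b g + s) (g * u) := by
  by_cases hgA : g ∈ A
  · exact hu.mul_amalgam hl hA hcv hc hgA hs
  · exact hu.mul_letter hl hA hcv hc hg hgA hs

end Lengths

/-! ## Convolution bounds for amalgams -/

section AmalgamConvolution

variable {Γ : Type*} [Group Γ] {A : Subgroup Γ} {S : Bool → Subgroup Γ} {l : Bool → Γ → ℕ}
  {n s : ℕ} {c D : ℝ} {b : Bool} {u : Γ} {W : List Γ}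

theorem IsLengthPair.exists_type_of_length_le_one (hl : IsLengthPair A S l) {M : List Γ}
    (hM : IsAlternating A S b M) (hlen : M.length ≤ 1) :
    ∃ b', b'.toNat ≤ M.length ∧ M.prod ∈ S b' ∧ l b' M.prod ≤ altLength l b M := by
  match M with
  | [] => exact ⟨false, le_rfl, (S false).one_mem, (hl.one false).le⟩
  | [g] => exact ⟨b, b.toNat_le, by simpa using hM.1, by simp [altLength]⟩

theorem IsLengthPair.exists_length_centre_le (hl : IsLengthPair A S l) (hA : IsAmalgamPair A S)
    (hcv : ConversionBound A l n c) (hc : 0 ≤ c) (hn : (n : ℝ) ≤ D) {W₁ M W₂ : List Γ} {m₁ m₂ : Γ}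
    (hW : IsAlternating A S b (W₁ ++ M ++ W₂)) (hM : M.length ≤ 1)
    (hD : 2 * (altLength l b (W₁ ++ M ++ W₂) : ℝ) ≤ D)
    (hm₁ : IsMinimalRep A S l (W₁.prod : Γ) m₁) (hm₂ : IsMinimalRep A S l (W₂.prod⁻¹ : Γ) m₂) :
    ∃ b', b'.toNat ≤ M.length ∧ m₁⁻¹ * (W₁ ++ M ++ W₂).prod * m₂ ∈ S b' ∧
      (l b' (m₁⁻¹ * (W₁ ++ M ++ W₂).prod * m₂) : ℝ) ≤
        D * (1 + c) ^ (W₁ ++ M ++ W₂).length := by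
  have hD0 : 0 ≤ D := n.cast_nonneg.trans hn
  obtain ⟨hW₁M, b₂, hW₂, hlen⟩ := hW.append l
  obtain ⟨hW₁, b₁, hMalt, hlen₁⟩ := hW₁M.append l
  obtain ⟨b', hb', hMS, hMl⟩ := hl.exists_type_of_length_le_one hMalt hM
  rw [hlen, hlen₁, Nat.cast_add, Nat.cast_add] at hD
  have : (0 : ℝ) ≤ altLength l b W₁ := Nat.cast_nonneg _
  have : (0 : ℝ) ≤ altLength l b₁ M := Nat.cast_nonneg _
  have : (0 : ℝ) ≤ altLength l b₂ W₂ := Nat.cast_nonneg _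
  obtain ⟨hA₁, hle₁⟩ := hm₁.length_inv_mul_le hl hA hcv hc hn hW₁ (by linarith)
  obtain ⟨hA₂, hle₂⟩ := hm₂.length_mul_le hl hA hcv hc hn hW₂ (by linarith)
  have hS₁ := (S b').inv_mem (hA.le b' hA₁)
  have hS₁M := (S b').mul_mem hS₁ hMS
  have hcentre : m₁⁻¹ * (W₁ ++ M ++ W₂).prod * m₂ =
      (W₁.prod⁻¹ * m₁)⁻¹ * M.prod * (W₂.prod * m₂) := by
    simp only [List.prod_append]; group
  rw [hcentre]
  refine ⟨b', hb', (S b').mul_mem hS₁M (hA.le b' hA₂), ?_⟩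
  have hmul := hl.mul_le b' _ hS₁M _ (hA.le b' hA₂)
  have hmul₁ := hl.mul_le b' _ hS₁ _ hMS
  rw [hl.inv b' _ (hA.le b' hA₁)] at hmul₁
  have hexc := conversionExcess_add_le hD0 hc W₁.length W₂.length
  have hmono := conversionExcess_mono hD0 hc
    (show W₁.length + W₂.length ≤ (W₁ ++ M ++ W₂).length by simp)
  rify at hmul hmul₁ hMl
  rw [← add_conversionExcess]
  linarith [hle₁ b', hle₂ b']

theorem IsLengthPair.exists_markers_of_alternating (hl : IsLengthPair A S l)
    (hA : IsAmalgamPair A S) (hcv : ConversionBound A l n c) (hc : 0 ≤ c) {m : Γ ⧸ A → Γ}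
    (hm : ∀ q, IsMinimalRep A S l q (m q)) (hW : IsAlternating A S b W) (hlen : W.length ≤ n)
    (hle : (altLength l b W : ℝ) ≤ n * (1 + c) ^ (n - W.length)) (z : Γ) :
    ∃ b' k k', k + b'.toNat ≤ n ∧ k' + b'.toNat ≤ n ∧
      prefixCoset A S k W.prod = prefixCoset A S k z ∧
      prefixCoset A S k' (W.prod⁻¹ : Γ) = prefixCoset A S k' (W.prod⁻¹ * z : Γ) ∧
      (m (prefixCoset A S k W.prod))⁻¹ * W.prod * m (prefixCoset A S k' (W.prod⁻¹ : Γ)) ∈ S b' ∧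
      (l b' ((m (prefixCoset A S k W.prod))⁻¹ * W.prod *
        m (prefixCoset A S k' (W.prod⁻¹ : Γ))) : ℝ) ≤ 2 * n * (1 + c) ^ n := by
  obtain ⟨W₁, M, W₂, rfl, hM, hz₁, hz₂⟩ := hA.exists_divergence hW z
  have hu₁ : prefixCoset A S W₁.length ((W₁ ++ M ++ W₂).prod : Γ) = (W₁.prod : Γ) := by
    rw [List.append_assoc] at hW ⊢
    exact hA.prefixCoset_append hW
  have hu₂ := hA.prefixCoset_append_inv hW
  set D : ℝ := 2 * (n * (1 + c) ^ (n - (W₁ ++ M ++ W₂).length)) with hD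
  have hnD : (n : ℝ) ≤ D := by
    have : (n : ℝ) ≤ n * (1 + c) ^ (n - (W₁ ++ M ++ W₂).length) :=
      le_mul_of_one_le_right n.cast_nonneg (one_le_pow₀ (by linarith))
    linarith [n.cast_nonneg (α := ℝ)]
  have hDpow : D * (1 + c) ^ (W₁ ++ M ++ W₂).length = 2 * n * (1 + c) ^ n := by
    rw [hD, mul_assoc, mul_assoc, ← pow_add, Nat.sub_add_cancel hlen, mul_assoc]
  obtain ⟨b', hb', hS, hl'⟩ := hl.exists_length_centre_le hA hcv hc hnD hW hM (by linarith)
    (hm _) (hm _)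
  simp only [List.length_append] at hlen
  refine ⟨b', W₁.length, W₂.length, by omega, by omega, hu₁.trans hz₁.symm, hu₂.trans hz₂.symm, ?_⟩
  rw [hu₁, hu₂, ← hDpow]
  exact ⟨hS, hl'⟩

theorem HasShortForm.exists_markers (hl : IsLengthPair A S l) (hA : IsAmalgamPair A S)
    (hcv : ConversionBound A l n c) (hc : 0 ≤ c) {m : Γ ⧸ A → Γ}
    (hm : ∀ q, IsMinimalRep A S l q (m q)) (hs : s ≤ n) (hu : HasShortForm A S l n c s u) (z : Γ) :
    ∃ b k k', k + b.toNat ≤ n ∧ k' + b.toNat ≤ n ∧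
      prefixCoset A S k u = prefixCoset A S k z ∧
      prefixCoset A S k' (u⁻¹ : Γ) = prefixCoset A S k' (u⁻¹ * z : Γ) ∧
      (m (prefixCoset A S k u))⁻¹ * u * m (prefixCoset A S k' (u⁻¹ : Γ)) ∈ S b ∧
      (l b ((m (prefixCoset A S k u))⁻¹ * u * m (prefixCoset A S k' (u⁻¹ : Γ))) : ℝ) ≤
        2 * n * (1 + c) ^ n := by
  have hmono := conversionExcess_mono (D := n) n.cast_nonneg hc
  have hsn : (s : ℝ) ≤ n := by exact_mod_cast hs
  rcases hu with ⟨huA, h⟩ | ⟨b, g, V, t, hW, hlen, rfl, h⟩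
  · have hm1 : m (1 : Γ) = 1 := (hm _).eq_one hA
    refine ⟨false, 0, 0, Nat.zero_le _, Nat.zero_le _, ?_⟩
    simp only [hA.prefixCoset_zero, hm1, inv_one, one_mul, mul_one, true_and]
    refine ⟨hA.le false huA, ?_⟩
    have hpow : (0 : ℝ) ≤ n * (1 + c) ^ n := mul_nonneg n.cast_nonneg (pow_nonneg (by linarith) _)
    linarith [h false, hmono hs, add_conversionExcess (D := n) (c := c) n]
  · have hWn : (g :: V).length ≤ n := by simp only [List.length_cons]; omega
    have ht : t ≤ n - (g :: V).length := by simp only [List.length_cons]; omega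
    refine hl.exists_markers_of_alternating hA hcv hc hm hW hWn ?_ z
    rw [← add_conversionExcess]
    linarith [hmono ht]

theorem IsLengthPair.convolutionBound (hl : IsLengthPair A S l) (hA : IsAmalgamPair A S)
    (hcv : ConversionBound A l n c) (hc : 0 ≤ c) {C : ℝ≥0∞}
    (hC : ∀ b, ConvolutionBound {g | g ∈ S b ∧ (l b g : ℝ) ≤ 2 * n * (1 + c) ^ n} C) :
    ConvolutionBound {u | ∃ s ≤ n, HasShortForm A S l n c s u}
      (((n + 1) ^ 2 + n ^ 2 : ℕ) * C) := by
  choose m hm using hA.exists_isMinimalRep l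
  let radii (b : Bool) := Finset.range (n + 1 - b.toNat)
  let indices := Finset.univ.sigma fun b => radii b ×ˢ radii b
  have hcard : indices.card = (n + 1) ^ 2 + n ^ 2 := by
    simp [indices, radii, Finset.card_sigma, sq, add_comm]
  rw [← hcard]
  refine ConvolutionBound.of_markers indices
    (fun i => {g | g ∈ S i.1 ∧ (l i.1 g : ℝ) ≤ 2 * n * (1 + c) ^ n})
    (fun i w => m (prefixCoset A S i.2.1 w)) (fun i w => m (prefixCoset A S i.2.2 w))
    (fun i _ => hC i.1) ?_
  rintro u ⟨s, hs, hu⟩ z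
  obtain ⟨b, k, k', hk, hk', hz, hz', hS⟩ := hu.exists_markers hl hA hcv hc hm hs z
  refine ⟨⟨b, k, k'⟩, ?_, congrArg m hz, congrArg m hz', hS⟩
  simp only [indices, radii, Finset.mem_sigma, Finset.mem_univ, Finset.mem_product,
    Finset.mem_range, true_and]
  omega

end AmalgamConvolution

theorem le_div_mul_max {j : ℕ → ℝ} (hj : Monotone j)
    (hj' : AntitoneOn (fun n : ℕ => j n / n) (Set.Ici 1)) {m : ℕ} (hm : 1 ≤ m) (k : ℕ) :
    j k ≤ j m / m * max k m := by
  have hm₀ : (0 : ℝ) < m := by exact_mod_cast hm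
  rcases le_total k m with hkm | hmk
  · rw [max_eq_right (by exact_mod_cast hkm), div_mul_cancel₀ _ hm₀.ne']
    exact hj hkm
  · rw [max_eq_left (by exact_mod_cast hmk)]
    exact (div_le_iff₀ (by exact_mod_cast hm.trans hmk)).1
      (hj' (Set.mem_Ici.2 hm) (Set.mem_Ici.2 (hm.trans hmk)) hmk)

theorem one_add_div_pow_le_exp {x : ℝ} (hx : 0 ≤ x) (n : ℕ) : (1 + x / n) ^ n ≤ Real.exp x := by
  rcases eq_or_ne n 0 with rfl | hn
  · simpa using hx
  calc (1 + x / n) ^ n ≤ Real.exp (x / n) ^ n := by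
        gcongr
        rw [add_comm]
        exact Real.add_one_le_exp _
    _ = Real.exp x := by rw [← Real.exp_nat_mul, mul_div_cancel₀ _ (by exact_mod_cast hn)]

/-! ## The universal length function -/

section UniversalLength

variable {A : Type v} {G H : Type u} [Group A] [Group G] [Group H] (iG : A →* G) (iH : A →* H)
  {LG : G → ℕ} {LH : H → ℕ}

theorem universalLength_le (w : List (G ⊕ H)) :
    universalLength iG iH LG LH (wordProd iG iH w) ≤ wordLength LG LH w :=
  Nat.sInf_le ⟨w, rfl, rfl⟩

theorem exists_wordLength_eq_universalLength (LG : G → ℕ) (LH : H → ℕ) (k : Amalgam iG iH) :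
    ∃ w : List (G ⊕ H), wordProd iG iH w = k ∧
      wordLength LG LH w = universalLength iG iH LG LH k := by
  obtain ⟨w, hw⟩ := exists_wordProd_eq iG iH k
  exact Nat.sInf_mem (s := {n | ∃ w : List (G ⊕ H), wordProd iG iH w = k ∧ wordLength LG LH w = n})
    ⟨_, w, hw, rfl⟩

theorem exists_wordProd_eq_inv (hLG : IsLengthFunction LG) (hLH : IsLengthFunction LH)
    (w : List (G ⊕ H)) : ∃ w', wordProd iG iH w' = (wordProd iG iH w)⁻¹ ∧
      wordLength LG LH w' = wordLength LG LH w := by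
  induction w with
  | nil => exact ⟨[], by simp [wordProd], rfl⟩
  | cons x w ih =>
    obtain ⟨w', hprod, hlen⟩ := ih
    simp only [wordProd, wordLength] at hprod hlen
    refine ⟨w' ++ [Sum.map (·⁻¹) (·⁻¹) x], ?_, ?_⟩
    · cases x <;> simp [wordProd, hprod]
    · cases x <;> simp [wordLength, hlen, hLG.inv, hLH.inv, add_comm]

theorem isLengthFunction_universalLength (hLG : IsLengthFunction LG) (hLH : IsLengthFunction LH) :
    IsLengthFunction (universalLength iG iH LG LH) := by
  have hinv (k) : universalLength iG iH LG LH k⁻¹ ≤ universalLength iG iH LG LH k := by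
    obtain ⟨w, rfl, hw⟩ := exists_wordLength_eq_universalLength iG iH LG LH k
    obtain ⟨w', hprod, hlen⟩ := exists_wordProd_eq_inv iG iH hLG hLH w
    rw [← hw, ← hprod, ← hlen]
    exact universalLength_le iG iH w'
  refine ⟨?_, fun k => (hinv k).antisymm (by simpa using hinv k⁻¹), fun k₁ k₂ => ?_⟩
  · simpa [wordProd, wordLength] using universalLength_le iG iH (LG := LG) (LH := LH) []
  · obtain ⟨w₁, rfl, h₁⟩ := exists_wordLength_eq_universalLength iG iH LG LH k₁
    obtain ⟨w₂, rfl, h₂⟩ := exists_wordLength_eq_universalLength iG iH LG LH k₂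
    rw [← h₁, ← h₂]
    simpa [wordProd, wordLength] using
      universalLength_le iG iH (LG := LG) (LH := LH) (w₁ ++ w₂)

/-- The two length functions, as a family. -/
def pairLength (LG : G → ℕ) (LH : H → ℕ) : ∀ b, GroupPair G H b → ℕ
  | false => LG
  | true => LH

theorem isLengthFunction_pairLength (hLG : IsLengthFunction LG) (hLH : IsLengthFunction LH) :
    ∀ b, IsLengthFunction (pairLength LG LH b)
  | false => hLG
  | true => hLH

theorem hasDecay_pairLength {f : ℕ → ℝ} (hG : HasDecay LG f) (hH : HasDecay LH f) :
    ∀ b, HasDecay (pairLength LG LH b) f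
  | false => hG
  | true => hH

/-- The image of the `b`-th group in the amalgam. -/
def amalgamFactor (b : Bool) : Subgroup (Amalgam iG iH) :=
  (Monoid.PushoutI.of (φ := pairHom iG iH) b).range

/-- The image in the amalgam of the common subgroup. -/
def amalgamBase : Subgroup (Amalgam iG iH) := (Monoid.PushoutI.base (pairHom iG iH)).range

/-- The length functions of the two groups, transported to their images in the amalgam. Off the
image of the `b`-th group the value is meaningless. -/
noncomputable def factorLength (LG : G → ℕ) (LH : H → ℕ) (b : Bool) (k : Amalgam iG iH) : ℕ :=
  pairLength LG LH b (Function.invFun (Monoid.PushoutI.of (φ := pairHom iG iH) b) k)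

variable {iG iH}

theorem pairHom_injective (hiG : Function.Injective iG) (hiH : Function.Injective iH) :
    ∀ b, Function.Injective (pairHom iG iH b)
  | false => hiG
  | true => hiH

theorem factorLength_of (hiG : Function.Injective iG) (hiH : Function.Injective iH) (b : Bool)
    (g : GroupPair G H b) :
    factorLength iG iH LG LH b (Monoid.PushoutI.of b g) = pairLength LG LH b g := by
  unfold factorLength
  rw [Function.leftInverse_invFun
    (Monoid.PushoutI.of_injective (pairHom_injective hiG hiH) b)]

theorem factorLength_base (hiG : Function.Injective iG) (hiH : Function.Injective iH) (b : Bool)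
    (a : A) : factorLength iG iH LG LH b (Monoid.PushoutI.base (pairHom iG iH) a) =
      pairLength LG LH b (pairHom iG iH b a) := by
  rw [← Monoid.PushoutI.of_apply_eq_base (pairHom iG iH) b, factorLength_of hiG hiH]

theorem IsAlternating.exists_reduced {b : Bool} {W : List (Amalgam iG iH)}
    (hW : IsAlternating (amalgamBase iG iH) (amalgamFactor iG iH) b W) :
    ∃ w : List (Σ b, GroupPair G H b), w.IsChain (fun x y => x.1 ≠ y.1) ∧
      (∀ x ∈ w, x.2 ∉ (pairHom iG iH x.1).range) ∧ (∀ x ∈ w.head?, x.1 = b) ∧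
      (w.map fun x => (Monoid.PushoutI.of x.1 x.2 : Amalgam iG iH)) = W := by
  induction W generalizing b with
  | nil => exact ⟨[], by simp⟩
  | cons k W ih =>
    obtain ⟨⟨g, rfl⟩, hgA, hW⟩ := hW
    obtain ⟨w, hchain, hnotMem, hhead, rfl⟩ := ih hW
    refine ⟨⟨b, g⟩ :: w, List.isChain_cons.2 ⟨fun y hy => by simp [hhead y hy], hchain⟩,
      List.forall_mem_cons.2 ⟨?_, hnotMem⟩, by simp, by simp⟩
    rintro ⟨a, ha⟩
    refine hgA ⟨a, ?_⟩
    rw [← Monoid.PushoutI.of_apply_eq_base _ b, show pairHom iG iH b a = g from ha]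

theorem isAmalgamPair (hiG : Function.Injective iG) (hiH : Function.Injective iH) :
    IsAmalgamPair (amalgamBase iG iH) (amalgamFactor iG iH) where
  le b := by
    rintro _ ⟨a, rfl⟩
    exact ⟨pairHom iG iH b a, Monoid.PushoutI.of_apply_eq_base (pairHom iG iH) b a⟩
  prod_notMem b W hW hne hmem := by
    obtain ⟨w, hchain, hnotMem, -, rfl⟩ := hW.exists_reduced
    let w' : Monoid.CoprodI.Word (GroupPair G H) :=
      ⟨w, fun x hx h => hnotMem x hx (by rw [h]; exact Subgroup.one_mem _), hchain⟩
    have hreduced : Monoid.PushoutI.Reduced (pairHom iG iH) w' := hnotMem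
    have hprod : Monoid.PushoutI.ofCoprodI w'.prod =
        (w.map fun x => (Monoid.PushoutI.of x.1 x.2 : Amalgam iG iH)).prod := by
      rw [Monoid.CoprodI.Word.prod, map_list_prod, List.map_map]
      congr 1
    have hempty := hreduced.eq_empty_of_mem_range (pairHom_injective hiG hiH) (hprod ▸ hmem)
    exact hne (by rw [show w = [] from congrArg Monoid.CoprodI.Word.toList hempty, List.map_nil])
  iSup_eq_top := eq_top_iff.2 fun k _ => by
    induction k using Monoid.PushoutI.induction_on with
    | of b g => exact Subgroup.mem_iSup_of_mem b ⟨g, rfl⟩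
    | base a =>
      rw [← Monoid.PushoutI.of_apply_eq_base (pairHom iG iH) false]
      exact Subgroup.mem_iSup_of_mem false ⟨_, rfl⟩
    | mul x y hx hy => exact mul_mem (hx trivial) (hy trivial)

theorem isLengthPair_factorLength (hiG : Function.Injective iG) (hiH : Function.Injective iH)
    (hLG : IsLengthFunction LG) (hLH : IsLengthFunction LH) (hz : ZerosInAmalgam iG iH LG LH) :
    IsLengthPair (amalgamBase iG iH) (amalgamFactor iG iH) (factorLength iG iH LG LH) where
  one b := by
    rw [← map_one (Monoid.PushoutI.of (φ := pairHom iG iH) b), factorLength_of hiG hiH]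
    exact (isLengthFunction_pairLength hLG hLH b).one
  inv b := by
    rintro _ ⟨g, rfl⟩
    rw [← map_inv, factorLength_of hiG hiH, factorLength_of hiG hiH]
    exact (isLengthFunction_pairLength hLG hLH b).inv g
  mul_le b := by
    rintro _ ⟨g, rfl⟩ _ ⟨h, rfl⟩
    rw [← map_mul]
    simp only [factorLength_of hiG hiH]
    exact (isLengthFunction_pairLength hLG hLH b).mul_le g h
  zero b := by
    rintro _ ⟨g, rfl⟩ h
    rw [factorLength_of hiG hiH] at h
    obtain ⟨a, rfl⟩ : ∃ a, pairHom iG iH b a = g := by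
      cases b
      · exact hz.left g h
      · exact hz.right g h
    rw [Monoid.PushoutI.of_apply_eq_base, factorLength_base hiG hiH]
    refine ⟨⟨a, rfl⟩, ?_⟩
    cases b
    · exact (hz.iff a).1 h
    · exact (hz.iff a).2 h

theorem hasShortForm_wordProd (hiG : Function.Injective iG) (hiH : Function.Injective iH)
    (hLG : IsLengthFunction LG) (hLH : IsLengthFunction LH) (hz : ZerosInAmalgam iG iH LG LH)
    {n : ℕ} {c : ℝ} (hc : 0 ≤ c)
    (hcv : ConversionBound (amalgamBase iG iH) (factorLength iG iH LG LH) n c)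
    (w : List (G ⊕ H)) (hw : wordLength LG LH w ≤ n) :
    HasShortForm (amalgamBase iG iH) (amalgamFactor iG iH) (factorLength iG iH LG LH) n c
      (wordLength LG LH w) (wordProd iG iH w) := by
  have hl := isLengthPair_factorLength hiG hiH hLG hLH hz
  induction w with
  | nil => exact hl.hasShortForm_one
  | cons x w ih =>
    have hcons (b : Bool) (g : GroupPair G H b)
        (h : pairLength LG LH b g + wordLength LG LH w ≤ n) :
        HasShortForm (amalgamBase iG iH) (amalgamFactor iG iH) (factorLength iG iH LG LH) n c
          (pairLength LG LH b g + wordLength LG LH w)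
          (Monoid.PushoutI.of b g * wordProd iG iH w) := by
      have := (ih (by omega)).mul hl (isAmalgamPair hiG hiH) hcv hc (b := b)
        (g := Monoid.PushoutI.of b g) ⟨g, rfl⟩
      rw [factorLength_of hiG hiH] at this
      exact this h
    cases x with
    | inl g => exact hcons false g hw
    | inr h => exact hcons true h hw

theorem IsDistorted.apply_zero_nonneg {j : ℕ → ℝ}
    (hd : IsDistorted (fun n => n + j n) (LG ∘ iG) (LH ∘ iH)) (hLG : IsLengthFunction LG)
    (hLH : IsLengthFunction LH) : 0 ≤ j 0 := by
  simpa [hLG.one, hLH.one] using (hd 1).1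

theorem conversionBound_factorLength (hiG : Function.Injective iG) (hiH : Function.Injective iH)
    (hz : ZerosInAmalgam iG iH LG LH) {j : ℕ → ℝ} (hj : Monotone j)
    (hj' : AntitoneOn (fun n : ℕ => j n / n) (Set.Ici 1)) (hj₀ : 0 ≤ j 0)
    (hd : IsDistorted (fun n => n + j n) (LG ∘ iG) (LH ∘ iH)) (n : ℕ) :
    ConversionBound (amalgamBase iG iH) (factorLength iG iH LG LH) n
      (j (max n 1) / (max n 1 : ℕ)) := by
  have hc : 0 ≤ j (max n 1) / (max n 1 : ℕ) :=
    div_nonneg (hj₀.trans (hj (Nat.zero_le _))) (Nat.cast_nonneg _)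
  have hle (k l : ℕ) (hkl : k = 0 → l = 0) (h : (l : ℝ) ≤ k + j k) :
      (l : ℝ) ≤ k + j (max n 1) / (max n 1 : ℕ) * max (k : ℝ) n := by
    rcases Nat.eq_zero_or_pos k with rfl | hk
    · rw [hkl rfl, Nat.cast_zero]
      positivity
    · refine h.trans (add_le_add_right ((le_div_mul_max hj hj' (le_max_right n 1) k).trans ?_) _)
      gcongr
      norm_cast
      omega
  rintro b _ ⟨a, rfl⟩
  rw [factorLength_base hiG hiH, factorLength_base hiG hiH]
  cases b
  · exact hle _ _ (hz.iff a).1 (hd a).2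
  · exact hle _ _ (hz.iff a).2 (hd a).1

theorem hasDecay_universalLength (hiG : Function.Injective iG) (hiH : Function.Injective iH)
    (hLG : IsLengthFunction LG) (hLH : IsLengthFunction LH) (hz : ZerosInAmalgam iG iH LG LH)
    {f j : ℕ → ℝ} (hj : Monotone j) (hj' : AntitoneOn (fun n : ℕ => j n / n) (Set.Ici 1))
    (hd : IsDistorted (fun n => n + j n) (LG ∘ iG) (LH ∘ iH)) (hG : HasDecay LG f)
    (hH : HasDecay LH f) : HasDecay (universalLength iG iH LG LH)
      (fun n => ((n + 1) ^ 2 + n ^ 2 : ℕ) * f ⌊2 * (n * Real.exp (j n))⌋₊) := by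
  have hf (n) : 0 ≤ f n := hG.nonneg hLG.one n
  refine hasDecay_of_convolutionBound (fun n => mul_nonneg (Nat.cast_nonneg _) (hf _)) fun n => ?_
  have hj₀ : 0 ≤ j 0 := hd.apply_zero_nonneg hLG hLH
  have hjn (m) : 0 ≤ j m := hj₀.trans (hj (Nat.zero_le m))
  set c := j (max n 1) / (max n 1 : ℕ) with hc_def
  have hc : 0 ≤ c := div_nonneg (hjn _) (Nat.cast_nonneg _)
  have hcv := conversionBound_factorLength hiG hiH hz hj hj' hj₀ hd n
  have hcn : 2 * n * (1 + c) ^ n ≤ 2 * (n * Real.exp (j n)) := by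
    rcases Nat.eq_zero_or_pos n with rfl | hn
    · simp
    · rw [hc_def, max_eq_left (Nat.succ_le_of_lt hn), mul_assoc]
      gcongr
      exact one_add_div_pow_le_exp (hjn n) n
  have hfactor (b) : ConvolutionBound {g | g ∈ amalgamFactor iG iH b ∧
      (factorLength iG iH LG LH b g : ℝ) ≤ 2 * n * (1 + c) ^ n}
      (ENNReal.ofReal (f ⌊2 * (n * Real.exp (j n))⌋₊)) := by
    refine (((hasDecay_pairLength hG hH b).convolutionBound _).map
      (Monoid.PushoutI.of_injective (pairHom_injective hiG hiH) b)).mono ?_ le_rfl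
    rintro _ ⟨⟨g, rfl⟩, hg⟩
    rw [factorLength_of hiG hiH] at hg
    exact ⟨g, Nat.le_floor (hg.trans hcn), rfl⟩
  refine ((isLengthPair_factorLength hiG hiH hLG hLH hz).convolutionBound (isAmalgamPair hiG hiH)
    hcv hc hfactor).mono (fun k hk => ?_) ?_
  · obtain ⟨w, rfl, hw⟩ := exists_wordLength_eq_universalLength iG iH LG LH k
    have hwn : wordLength LG LH w ≤ n := hw.trans_le hk
    exact ⟨_, hwn, hasShortForm_wordProd hiG hiH hLG hLH hz hc hcv w hwn⟩
  · rw [ENNReal.ofReal_mul (Nat.cast_nonneg _), ENNReal.ofReal_natCast]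

theorem hasDecay_universalLength_decayTilde (hiG : Function.Injective iG)
    (hiH : Function.Injective iH) (hLG : IsLengthFunction LG) (hLH : IsLengthFunction LH)
    (hz : ZerosInAmalgam iG iH LG LH) {f j : ℕ → ℝ} (hj : Monotone j)
    (hj' : AntitoneOn (fun n : ℕ => j n / n) (Set.Ici 1))
    (hd : IsDistorted (fun n => n + j n) (LG ∘ iG) (LH ∘ iH)) (hG : HasDecay LG f)
    (hH : HasDecay LH f) :
    HasDecay (universalLength iG iH LG LH) (fun n => decayTilde f (n * Real.exp (j n))) := by
  refine (hasDecay_universalLength hiG hiH hLG hLH hz hj hj' hd hG hH).mono fun n =>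
    mul_le_mul_of_nonneg_right ?_ (hG.nonneg hLG.one _)
  have hjn : 0 ≤ j n := (hd.apply_zero_nonneg hLG hLH).trans (hj (Nat.zero_le n))
  have hn : (n : ℝ) ≤ n * Real.exp (j n) :=
    le_mul_of_one_le_right n.cast_nonneg (Real.one_le_exp hjn)
  have : (0 : ℝ) ≤ n := n.cast_nonneg
  calc (((n + 1) ^ 2 + n ^ 2 : ℕ) : ℝ) ≤ (2 * (n * Real.exp (j n)) + 1) ^ 2 := by
        push_cast
        nlinarith
    _ = (2 * (n * Real.exp (j n)) + 1) ^ (2 : ℝ) := by norm_cast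
    _ ≤ (2 * (n * Real.exp (j n)) + 1) ^ (7 / 2 : ℝ) :=
        Real.rpow_le_rpow_of_exponent_le (by linarith) (by norm_num)

open Classical in
/-- The length function increased by one away from the identity, which makes it vanish only
there. -/
noncomputable def positiveLength {K : Type*} [One K] (L : K → ℕ) (k : K) : ℕ :=
  L k + if k = 1 then 0 else 1

theorem IsLengthFunction.positiveLength {K : Type*} [Group K] {L : K → ℕ}
    (hL : IsLengthFunction L) : IsLengthFunction (positiveLength L) where
  one := by simp [_root_.positiveLength, hL.one]
  inv k := by by_cases h : k = 1 <;> simp [_root_.positiveLength, hL.inv, h]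
  mul_le k k' := by
    have := hL.mul_le k k'
    unfold _root_.positiveLength
    by_cases h : k = 1
    · subst h; rw [one_mul]; exact Nat.le_add_left _ _
    · rw [if_neg h]
      split_ifs <;> omega

theorem positiveLength_of_ne_one {K : Type*} [One K] (L : K → ℕ) {k : K} (hk : k ≠ 1) :
    positiveLength L k = L k + 1 := by
  simp [positiveLength, hk]

theorem positiveLength_eq_zero {K : Type*} [Group K] {L : K → ℕ} (hL : IsLengthFunction L)
    {k : K} : positiveLength L k = 0 ↔ k = 1 := by
  unfold positiveLength
  by_cases h : k = 1 <;> simp [h, hL.one]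

theorem zerosInAmalgam_positiveLength (hiG : Function.Injective iG) (hiH : Function.Injective iH)
    (hLG : IsLengthFunction LG) (hLH : IsLengthFunction LH) :
    ZerosInAmalgam iG iH (positiveLength LG) (positiveLength LH) where
  left g h := ⟨1, by rw [(positiveLength_eq_zero hLG).1 h, map_one]⟩
  right g h := ⟨1, by rw [(positiveLength_eq_zero hLH).1 h, map_one]⟩
  iff a := by
    rw [positiveLength_eq_zero hLG, positiveLength_eq_zero hLH, map_eq_one_iff iG hiG,
      map_eq_one_iff iH hiH]

theorem IsDistorted.positiveLength {j : ℕ → ℝ} (hiG : Function.Injective iG)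
    (hiH : Function.Injective iH) (hLG : IsLengthFunction LG) (hLH : IsLengthFunction LH)
    (hj : Monotone j) (hd : IsDistorted (fun n => n + j n) (LG ∘ iG) (LH ∘ iH)) :
    IsDistorted (fun n => n + j n) (positiveLength LG ∘ iG) (positiveLength LH ∘ iH) := by
  intro a
  by_cases ha : a = 1
  · simpa [_root_.positiveLength, ha, hLG.one, hLH.one] using hd.apply_zero_nonneg hLG hLH
  · have h := hd a
    have hG := hj (Nat.le_succ (LG (iG a)))
    have hH := hj (Nat.le_succ (LH (iH a)))
    simp only [Function.comp_apply, Nat.succ_eq_add_one] at h hG hH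
    simp only [Function.comp_apply, positiveLength_of_ne_one LG ((map_ne_one_iff iG hiG).2 ha),
      positiveLength_of_ne_one LH ((map_ne_one_iff iH hiH).2 ha), Nat.cast_add, Nat.cast_one]
    constructor <;> linarith [h.1, h.2]

theorem exists_isLengthFunction_and_of_hasDecay (hiG : Function.Injective iG)
    (hiH : Function.Injective iH) (hLG : IsLengthFunction LG) (hLH : IsLengthFunction LH)
    {f j : ℕ → ℝ} (hj : Monotone j) (hj' : AntitoneOn (fun n : ℕ => j n / n) (Set.Ici 1))
    (hd : IsDistorted (fun n => n + j n) (LG ∘ iG) (LH ∘ iH)) (hG : HasDecay LG f)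
    (hH : HasDecay LH f) {P : (Amalgam iG iH → ℕ) → Prop}
    (hP : ∀ l, HasDecay l
      (fun n => ((n + 1) ^ 2 + n ^ 2 : ℕ) * f ⌊2 * (n * Real.exp (j n))⌋₊) → P l) :
    (∃ l, IsLengthFunction l ∧ P l) ∧
      (ZerosInAmalgam iG iH LG LH → P (universalLength iG iH LG LH)) := by
  refine ⟨⟨universalLength iG iH (positiveLength LG) (positiveLength LH),
    isLengthFunction_universalLength iG iH hLG.positiveLength hLH.positiveLength, hP _ ?_⟩,
    fun hz => hP _ (hasDecay_universalLength hiG hiH hLG hLH hz hj hj' hd hG hH)⟩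
  exact hasDecay_universalLength hiG hiH hLG.positiveLength hLH.positiveLength
    (zerosInAmalgam_positiveLength hiG hiH hLG hLH) hj hj' (hd.positiveLength hiG hiH hLG hLH hj)
    (hG.mono_length fun _ => Nat.le_add_right _ _) (hH.mono_length fun _ => Nat.le_add_right _ _)

end UniversalLength

/-! ## Growth of decay functions -/

section Growth

theorem exists_nonneg_forall_le_add {j g : ℕ → ℝ} (h : ∀ᶠ n in atTop, j n ≤ g n) :
    ∃ C, 0 ≤ C ∧ ∀ n, j n ≤ g n + C := by
  obtain ⟨C, hC⟩ := (isBoundedUnder_of_eventually_le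
    (h.mono fun n hn => sub_nonpos.2 hn)).bddAbove_range
  refine ⟨max C 0, le_max_right C 0, fun n => ?_⟩
  linarith [hC ⟨n, rfl⟩, le_max_left C 0]

theorem HasRDWith.exists_pow {K : Type*} [Group K] {l : K → ℕ} (h : HasRDWith l) :
    ∃ M : ℝ, 0 ≤ M ∧ ∃ d : ℕ, HasDecay l fun n => M * (n + 1) ^ d := by
  obtain ⟨p, hp⟩ := h
  refine ⟨∑ i ∈ Finset.range (p.natDegree + 1), |p.coeff i|,
    Finset.sum_nonneg fun _ _ => abs_nonneg _, p.natDegree, hp.mono fun n => ?_⟩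
  rw [Polynomial.eval_eq_sum_range, Finset.sum_mul]
  refine Finset.sum_le_sum fun i hi => ?_
  have hn : (0 : ℝ) ≤ n := n.cast_nonneg
  have hpow : (n : ℝ) ^ i ≤ (n + 1) ^ p.natDegree :=
    (pow_le_pow_left₀ hn (by linarith) i).trans
      (pow_le_pow_right₀ (by linarith) (by simpa [Nat.lt_succ_iff] using hi))
  calc p.coeff i * (n : ℝ) ^ i ≤ |p.coeff i| * (n : ℝ) ^ i := by
        gcongr
        exact le_abs_self _
    _ ≤ |p.coeff i| * (n + 1) ^ p.natDegree := by gcongr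

theorem HasRDWith.exists_common_pow {K K' : Type*} [Group K] [Group K'] {l : K → ℕ} {l' : K' → ℕ}
    (h : HasRDWith l) (h' : HasRDWith l') : ∃ M : ℝ, 0 ≤ M ∧ ∃ d : ℕ,
      HasDecay l (fun n => M * (n + 1) ^ d) ∧ HasDecay l' fun n => M * (n + 1) ^ d := by
  obtain ⟨M, hM, d, h⟩ := h.exists_pow
  obtain ⟨M', -, d', h'⟩ := h'.exists_pow
  refine ⟨max M M', hM.trans (le_max_left _ _), max d d', h.mono fun n => ?_, h'.mono fun n => ?_⟩
  · gcongr
    exacts [le_max_left _ _, by simp, le_max_left _ _]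
  · gcongr
    exacts [le_max_right _ _, by simp, le_max_right _ _]

/-- The functions growing at most subexponentially, in the form that is closed under products:
eventually below every exponential function of positive rate. No lower bound is imposed. -/
def HasSubexponentialGrowth (f : ℕ → ℝ) : Prop :=
  ∀ ε > 0, ∀ᶠ n : ℕ in atTop, f n ≤ Real.exp (ε * n)

variable {f g : ℕ → ℝ}

theorem HasSubexponentialGrowth.mono (hf : HasSubexponentialGrowth f) (h : ∀ n, g n ≤ f n) :
    HasSubexponentialGrowth g :=
  fun ε hε => (hf ε hε).mono fun n hn => (h n).trans hn

theorem HasSubexponentialGrowth.max (hf : HasSubexponentialGrowth f)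
    (hg : HasSubexponentialGrowth g) : HasSubexponentialGrowth fun n => max (f n) (g n) :=
  fun ε hε => ((hf ε hε).and (hg ε hε)).mono fun _ h => max_le h.1 h.2

theorem HasSubexponentialGrowth.mul (hf : HasSubexponentialGrowth f)
    (hg : HasSubexponentialGrowth g) (hg₀ : ∀ n, 0 ≤ g n) :
    HasSubexponentialGrowth fun n => f n * g n := by
  intro ε hε
  filter_upwards [hf _ (half_pos hε), hg _ (half_pos hε)] with n hfn hgn
  calc f n * g n ≤ Real.exp (ε / 2 * n) * Real.exp (ε / 2 * n) :=
        mul_le_mul hfn hgn (hg₀ n) (Real.exp_nonneg _)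
    _ = Real.exp (ε * n) := by rw [← Real.exp_add]; congr 1; ring

theorem hasSubexponentialGrowth_exp {j : ℕ → ℝ} (hj : j =o[atTop] fun n : ℕ => (n : ℝ)) :
    HasSubexponentialGrowth fun n => Real.exp (j n) := fun ε hε =>
  (hj.bound hε).mono fun n hn => Real.exp_le_exp.2 ((le_abs_self _).trans (by simpa using hn))

theorem isLittleO_const_natCast (a : ℝ) : (fun _ => a) =o[atTop] fun n : ℕ => (n : ℝ) :=
  isLittleO_const_left.2 (Or.inr (tendsto_norm_atTop_atTop.comp tendsto_natCast_atTop_atTop))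

theorem hasSubexponentialGrowth_const (a : ℝ) : HasSubexponentialGrowth fun _ => a :=
  (hasSubexponentialGrowth_exp (isLittleO_const_natCast a)).mono
    fun _ => by linarith [Real.add_one_le_exp a]

theorem hasSubexponentialGrowth_natCast_add_one : HasSubexponentialGrowth fun n => (n : ℝ) + 1 := by
  refine (hasSubexponentialGrowth_exp (j := fun n => Real.log (n + 1)) ?_).mono
    fun n => (Real.exp_log n.cast_add_one_pos).ge
  have h := Real.isLittleO_log_id_atTop.comp_tendsto
    (tendsto_atTop_add_const_right atTop (1 : ℝ) tendsto_natCast_atTop_atTop)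
  exact h.trans_isBigO ((isBigO_refl _ _).add (isLittleO_const_natCast 1).isBigO)

theorem HasSubexponentialGrowth.pow (hf : HasSubexponentialGrowth f) (hf₀ : ∀ n, 0 ≤ f n) (d : ℕ) :
    HasSubexponentialGrowth fun n => f n ^ d := by
  induction d with
  | zero => simpa only [pow_zero] using hasSubexponentialGrowth_const 1
  | succ d ih => simpa only [pow_succ] using ih.mul hf hf₀

theorem HasSubexponentialGrowth.comp_floor (hf : HasSubexponentialGrowth f) {C : ℝ} (hC : 0 < C) :
    HasSubexponentialGrowth fun n => f ⌊C * n⌋₊ := by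
  intro ε hε
  have htendsto : Tendsto (fun n : ℕ => ⌊C * (n : ℝ)⌋₊) atTop atTop :=
    tendsto_nat_floor_atTop.comp (tendsto_natCast_atTop_atTop.const_mul_atTop hC)
  filter_upwards [htendsto.eventually (hf (ε / C) (div_pos hε hC))] with n hn
  refine hn.trans (Real.exp_le_exp.2 ?_)
  calc ε / C * ⌊C * (n : ℝ)⌋₊ ≤ ε / C * (C * n) := by
        gcongr
        exact Nat.floor_le (by positivity)
    _ = ε * n := by field_simp

theorem IsSubexponential.hasSubexponentialGrowth (hf : IsSubexponential f) :
    HasSubexponentialGrowth f := by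
  intro ε hε
  filter_upwards [hf.2.eventually (eventually_lt_nhds (Real.one_lt_exp_iff.2 hε)),
    eventually_ne_atTop 0] with n hn hn₀
  calc f n = (f n ^ (1 / (n : ℝ))) ^ (n : ℝ) := by
        rw [← Real.rpow_mul (hf.1 n), one_div_mul_cancel (by exact_mod_cast hn₀), Real.rpow_one]
    _ ≤ Real.exp ε ^ (n : ℝ) :=
        Real.rpow_le_rpow (Real.rpow_nonneg (hf.1 n) _) hn.le (Nat.cast_nonneg _)
    _ = Real.exp (ε * n) := by rw [← Real.exp_mul]

theorem HasSubexponentialGrowth.isSubexponential (hf : HasSubexponentialGrowth f)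
    (hf₁ : ∀ n, 1 ≤ f n) : IsSubexponential f := by
  refine ⟨fun n => zero_le_one.trans (hf₁ n), tendsto_order.2 ⟨fun a ha =>
    Eventually.of_forall fun n => ha.trans_le (Real.one_le_rpow (hf₁ n) (by positivity)),
    fun a ha => ?_⟩⟩
  have hlog : 0 < Real.log a := Real.log_pos ha
  filter_upwards [hf _ (half_pos hlog), eventually_ne_atTop 0] with n hn hn₀
  have hn₀' : (n : ℝ) ≠ 0 := by exact_mod_cast hn₀
  calc f n ^ (1 / (n : ℝ)) ≤ Real.exp (Real.log a / 2 * n) ^ (1 / (n : ℝ)) :=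
        Real.rpow_le_rpow (zero_le_one.trans (hf₁ n)) hn (by positivity)
    _ = Real.exp (Real.log a / 2) := by
        rw [← Real.exp_mul]
        congr 1
        field_simp
    _ < Real.exp (Real.log a) := Real.exp_lt_exp.2 (half_lt_self hlog)
    _ = a := Real.exp_log (zero_lt_one.trans ha)

theorem HasDecay.hasSDWith {K : Type*} [Group K] {l : K → ℕ} (h : HasDecay l f)
    (hf : HasSubexponentialGrowth f) : HasSDWith l :=
  ⟨fun n => max 1 (f n), ((hasSubexponentialGrowth_const 1).max hf).isSubexponential
    fun _ => le_max_left _ _, h.mono fun _ => le_max_right _ _⟩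

theorem natCast_sq_add_sq_le (n : ℕ) : (((n + 1) ^ 2 + n ^ 2 : ℕ) : ℝ) ≤ 2 * (n + 1 : ℝ) ^ 2 := by
  push_cast
  nlinarith [n.cast_nonneg (α := ℝ)]

theorem hasSubexponentialGrowth_sq_add_sq_mul (hf : HasSubexponentialGrowth f)
    (hf₀ : ∀ n, 0 ≤ f n) :
    HasSubexponentialGrowth fun n => ((n + 1) ^ 2 + n ^ 2 : ℕ) * f n :=
  ((((hasSubexponentialGrowth_const 2).mul
    (hasSubexponentialGrowth_natCast_add_one.pow (fun _ => by positivity) 2)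
    fun _ => by positivity).mono natCast_sq_add_sq_le).mul hf hf₀)

end Growth

/-! ## Regularizing the distortion -/

section Distortion

theorem monotone_mul_one_add_log {k : ℝ} (hk : 0 ≤ k) :
    Monotone fun n : ℕ => k * (1 + Real.log n) := by
  intro m n hmn
  rcases Nat.eq_zero_or_pos m with rfl | hm
  · simpa [mul_add] using mul_nonneg hk (Real.log_natCast_nonneg n)
  · dsimp only
    gcongr

theorem antitoneOn_mul_one_add_log_div {k : ℝ} (hk : 0 ≤ k) :
    AntitoneOn (fun n : ℕ => k * (1 + Real.log n) / n) (Set.Ici 1) := by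
  have hlog (n : ℕ) (hn : 1 ≤ n) : k * (1 + Real.log n) / n =
      k * Real.exp 1 * (Real.log (Real.exp 1 * n) / (Real.exp 1 * n)) := by
    have : (n : ℝ) ≠ 0 := by positivity
    rw [Real.log_mul (Real.exp_ne_zero 1) this, Real.log_exp]
    field_simp
  intro m hm n hn hmn
  have hmem (n : ℕ) (hn : 1 ≤ n) : Real.exp 1 * n ∈ Set.Ici (Real.exp 1) :=
    le_mul_of_one_le_right (Real.exp_nonneg 1) (by exact_mod_cast hn)
  simp only [hlog m hm, hlog n hn]
  exact mul_le_mul_of_nonneg_left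
    (Real.log_div_self_antitoneOn (hmem m hm) (hmem n hn) (by gcongr)) (by positivity)

theorem exists_nat_mul_one_add_log_ge {j : ℕ → ℝ} (hj : j =O[atTop] fun n : ℕ => Real.log n) :
    ∃ k : ℕ, ∀ n, j n ≤ k * (1 + Real.log n) := by
  obtain ⟨c, hc⟩ := hj.bound
  obtain ⟨C, -, hC⟩ := exists_nonneg_forall_le_add (hc.mono fun n hn => (le_abs_self _).trans hn)
  obtain ⟨k, hk⟩ := exists_nat_ge (max c C)
  refine ⟨k, fun n => ?_⟩
  have hlog := Real.log_natCast_nonneg n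
  calc j n ≤ c * Real.log n + C := by simpa only [Real.norm_of_nonneg hlog] using hC n
    _ ≤ k * Real.log n + k := by
        gcongr
        exacts [(le_max_left c C).trans hk, (le_max_right c C).trans hk]
    _ = k * (1 + Real.log n) := by ring

variable {ι : Type*} {s t : ι → ℝ}

theorem bddBelow_range_affine (hs : ∀ i, 0 ≤ s i) (ht : ∀ i, 0 ≤ t i) (n : ℕ) :
    BddBelow (Set.range fun i => s i * n + t i) := by
  refine ⟨0, ?_⟩
  rintro _ ⟨i, rfl⟩
  have := hs i
  have := ht i
  positivity

theorem monotone_iInf_affine (hs : ∀ i, 0 ≤ s i) (ht : ∀ i, 0 ≤ t i) :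
    Monotone fun n : ℕ => ⨅ i, (s i * n + t i) := fun m n hmn =>
  ciInf_mono (bddBelow_range_affine hs ht m) fun i => by
    have := hs i
    gcongr

theorem antitoneOn_iInf_affine_div [Nonempty ι] (hs : ∀ i, 0 ≤ s i) (ht : ∀ i, 0 ≤ t i) :
    AntitoneOn (fun n : ℕ => (⨅ i, (s i * n + t i)) / n) (Set.Ici 1) := by
  intro m hm n hn hmn
  have hm₀ : (0 : ℝ) < m := by exact_mod_cast Set.mem_Ici.1 hm
  have hn₀ : (0 : ℝ) < n := by exact_mod_cast Set.mem_Ici.1 hn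
  dsimp only
  rw [le_div_iff₀ hm₀]
  refine le_ciInf fun i => ?_
  calc (⨅ i, (s i * n + t i)) / n * m ≤ (s i * n + t i) / n * m := by
        gcongr
        exact ciInf_le (bddBelow_range_affine hs ht n) i
    _ = s i * m + t i * (m / n) := by field_simp
    _ ≤ s i * m + t i := by
        gcongr
        exact mul_le_of_le_one_right (ht i) ((div_le_one hn₀).2 (by exact_mod_cast hmn))

theorem exists_regular_sublinear_ge {j : ℕ → ℝ} (hj : j =o[atTop] (fun n : ℕ => (n : ℝ))) :
    ∃ j' : ℕ → ℝ, (∀ n, j n ≤ j' n) ∧ Monotone j' ∧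
      AntitoneOn (fun n : ℕ => j' n / n) (Set.Ici 1) ∧ j' =o[atTop] fun n : ℕ => (n : ℝ) := by
  have hs (k : ℕ) : 0 ≤ 1 / ((k : ℝ) + 1) := by positivity
  have haffine (k : ℕ) : ∃ t, 0 ≤ t ∧ ∀ n : ℕ, j n ≤ 1 / ((k : ℝ) + 1) * n + t :=
    exists_nonneg_forall_le_add ((hj.bound (c := 1 / ((k : ℝ) + 1)) (by positivity)).mono
      fun n hn => (le_abs_self _).trans (by simpa using hn))
  choose t ht hjt using haffine
  refine ⟨fun n => ⨅ k : ℕ, (1 / ((k : ℝ) + 1) * n + t k), fun n => le_ciInf fun k => hjt k n,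
    monotone_iInf_affine hs ht, antitoneOn_iInf_affine_div hs ht, isLittleO_iff.2 fun ε hε => ?_⟩
  obtain ⟨k, hk⟩ := exists_nat_one_div_lt (half_pos hε)
  filter_upwards [tendsto_natCast_atTop_atTop.eventually_ge_atTop (t k / (ε / 2))] with n hn
  rw [Real.norm_of_nonneg (Real.iInf_nonneg fun k => add_nonneg (mul_nonneg (hs k) n.cast_nonneg)
    (ht k)), Real.norm_natCast]
  calc ⨅ k : ℕ, (1 / ((k : ℝ) + 1) * n + t k) ≤ 1 / ((k : ℝ) + 1) * n + t k :=
        ciInf_le (bddBelow_range_affine hs ht n) k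
    _ ≤ ε / 2 * n + ε / 2 * n := by
        gcongr
        exact (div_le_iff₀' (half_pos hε)).1 hn
    _ = ε * n := by ring

theorem IsDistorted.mono {K : Type*} {l₁ l₂ : K → ℕ} {j j' : ℕ → ℝ}
    (h : IsDistorted (fun n => n + j n) l₁ l₂) (hj : ∀ n, j n ≤ j' n) :
    IsDistorted (fun n => n + j' n) l₁ l₂ := fun k =>
  ⟨(h k).1.trans (add_le_add le_rfl (hj _)), (h k).2.trans (add_le_add le_rfl (hj _))⟩

end Distortion

/-! ## Rapid and subexponential decay of amalgams -/

section SpecialCases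

theorem HasDecay.hasRDWith_of_log {K : Type*} [Group K] {l : K → ℕ} {M : ℝ} (hM : 0 ≤ M) {d k : ℕ}
    (h : HasDecay l fun n => ((n + 1) ^ 2 + n ^ 2 : ℕ) *
      (M * (⌊2 * (n * Real.exp (k * (1 + Real.log n)))⌋₊ + 1) ^ d)) : HasRDWith l := by
  refine ⟨((Polynomial.X + 1) ^ 2 + Polynomial.X ^ 2) * (Polynomial.C M *
    (2 * (Polynomial.C (Real.exp k) * Polynomial.X ^ (k + 1)) + 1) ^ d), h.mono fun n => ?_⟩
  have hexp : (n : ℝ) * Real.exp (k * (1 + Real.log n)) = Real.exp k * (n : ℝ) ^ (k + 1) := by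
    rcases Nat.eq_zero_or_pos n with rfl | hn
    · simp
    · rw [mul_add, mul_one, Real.exp_add, Real.exp_nat_mul (Real.log n),
        Real.exp_log (by exact_mod_cast hn)]
      ring
  have hfloor : (⌊2 * (n * Real.exp (k * (1 + Real.log n)))⌋₊ : ℝ) ≤
      2 * (Real.exp k * (n : ℝ) ^ (k + 1)) := by
    rw [hexp]
    exact Nat.floor_le (by positivity)
  push_cast
  simp only [Polynomial.eval_mul, Polynomial.eval_add, Polynomial.eval_pow, Polynomial.eval_X,
    Polynomial.eval_one, Polynomial.eval_C, Polynomial.eval_ofNat]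
  gcongr

theorem hasSubexponentialGrowth_pow_floor_exp {j : ℕ → ℝ} (hj : j =o[atTop] fun n : ℕ => (n : ℝ))
    (M : ℝ) (d : ℕ) :
    HasSubexponentialGrowth fun n => M * (⌊2 * (n * Real.exp (j n))⌋₊ + 1) ^ d := by
  have hlinear : HasSubexponentialGrowth fun n => (⌊2 * (n * Real.exp (j n))⌋₊ + 1 : ℝ) := by
    refine ((((hasSubexponentialGrowth_const 2).mul hasSubexponentialGrowth_natCast_add_one
      fun n => by positivity).mul ((hasSubexponentialGrowth_const 1).max
        (hasSubexponentialGrowth_exp hj)) fun n => by positivity)).mono fun n => ?_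
    have hfloor : (⌊2 * (n * Real.exp (j n))⌋₊ : ℝ) ≤ 2 * n * max 1 (Real.exp (j n)) := by
      rw [mul_assoc 2]
      refine (Nat.floor_le (by positivity)).trans ?_
      gcongr
      exact le_max_right _ _
    linarith [le_max_left 1 (Real.exp (j n))]
  exact (hasSubexponentialGrowth_const M).mul (hlinear.pow (fun _ => by positivity) d)
    fun _ => by positivity

variable {A : Type v} {G H : Type u} [Group A] [Group G] [Group H] {iG : A →* G} {iH : A →* H}
  {LG : G → ℕ} {LH : H → ℕ}

theorem hasRD_amalgam (hiG : Function.Injective iG) (hiH : Function.Injective iH)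
    (hLG : IsLengthFunction LG) (hLH : IsLengthFunction LH) {j : ℕ → ℝ}
    (hd : IsDistorted (fun n => n + j n) (LG ∘ iG) (LH ∘ iH))
    (hj : j =O[atTop] (fun n : ℕ => Real.log n)) (hG : HasRDWith LG) (hH : HasRDWith LH) :
    HasRD (Amalgam iG iH) ∧
      (ZerosInAmalgam iG iH LG LH → HasRDWith (universalLength iG iH LG LH)) := by
  obtain ⟨M, hM, d, hG, hH⟩ := hG.exists_common_pow hH
  obtain ⟨k, hk⟩ := exists_nat_mul_one_add_log_ge hj
  exact exists_isLengthFunction_and_of_hasDecay hiG hiH hLG hLH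
    (monotone_mul_one_add_log k.cast_nonneg) (antitoneOn_mul_one_add_log_div k.cast_nonneg)
    (hd.mono hk) hG hH fun _ h => h.hasRDWith_of_log hM

theorem hasSD_amalgam_of_isLittleO (hiG : Function.Injective iG) (hiH : Function.Injective iH)
    (hLG : IsLengthFunction LG) (hLH : IsLengthFunction LH) {j : ℕ → ℝ}
    (hd : IsDistorted (fun n => n + j n) (LG ∘ iG) (LH ∘ iH))
    (hj : j =o[atTop] (fun n : ℕ => (n : ℝ))) (hG : HasRDWith LG) (hH : HasRDWith LH) :
    HasSD (Amalgam iG iH) ∧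
      (ZerosInAmalgam iG iH LG LH → HasSDWith (universalLength iG iH LG LH)) := by
  obtain ⟨M, hM, d, hG, hH⟩ := hG.exists_common_pow hH
  obtain ⟨j', hjj', hmono, hanti, hj'⟩ := exists_regular_sublinear_ge hj
  exact exists_isLengthFunction_and_of_hasDecay hiG hiH hLG hLH hmono hanti (hd.mono hjj') hG hH
    fun _ h => h.hasSDWith <| hasSubexponentialGrowth_sq_add_sq_mul
      (hasSubexponentialGrowth_pow_floor_exp hj' M d) fun _ => by positivity

theorem hasSD_amalgam_of_isBigO_one (hiG : Function.Injective iG) (hiH : Function.Injective iH)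
    (hLG : IsLengthFunction LG) (hLH : IsLengthFunction LH) {j : ℕ → ℝ}
    (hd : IsDistorted (fun n => n + j n) (LG ∘ iG) (LH ∘ iH))
    (hj : j =O[atTop] (fun _ : ℕ => (1 : ℝ))) (hG : HasSDWith LG) (hH : HasSDWith LH) :
    HasSD (Amalgam iG iH) ∧
      (ZerosInAmalgam iG iH LG LH → HasSDWith (universalLength iG iH LG LH)) := by
  obtain ⟨f, hf, hG⟩ := hG
  obtain ⟨f', hf', hH⟩ := hH
  obtain ⟨C, hC⟩ := isBigO_one_nat_atTop_iff.1 hj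
  have hC₀ : 0 ≤ C := (norm_nonneg (j 0)).trans (hC 0)
  refine exists_isLengthFunction_and_of_hasDecay (j := fun _ => C) hiG hiH hLG hLH monotone_const
    (fun m hm n _ hmn => ?_) (hd.mono fun n => (le_abs_self _).trans (hC n))
    (hG.mono fun n => le_max_left (f n) (f' n)) (hH.mono fun n => le_max_right (f n) (f' n))
    fun l h => h.hasSDWith <| hasSubexponentialGrowth_sq_add_sq_mul ?_
      fun n => le_max_of_le_left (hf.1 _)
  · have : (0 : ℝ) < m := by exact_mod_cast Set.mem_Ici.1 hm
    dsimp only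
    gcongr
  · have := (hf.hasSubexponentialGrowth.max hf'.hasSubexponentialGrowth).comp_floor
      (C := 2 * Real.exp C) (by positivity)
    simpa only [mul_assoc, mul_comm (Real.exp C)] using this

end SpecialCases

theorem mainTheorem4 {A : Type v} {G H : Type u} [Group A] [Group G] [Group H]
    (iG : A →* G) (iH : A →* H)
    (hiG : Function.Injective iG) (hiH : Function.Injective iH)
    (LG : G → ℕ) (LH : H → ℕ) (hLG : IsLengthFunction LG) (hLH : IsLengthFunction LH) :
    -- the universal length function is a length function
    IsLengthFunction (universalLength iG iH LG LH) ∧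
    -- the general estimate
    (ZerosInAmalgam iG iH LG LH →
      ∀ f j : ℕ → ℝ, Monotone j → AntitoneOn (fun n : ℕ => j n / n) (Set.Ici 1) →
        IsDistorted (fun n => n + j n) (LG ∘ iG) (LH ∘ iH) →
        HasDecay LG f → HasDecay LH f →
        HasDecay (universalLength iG iH LG LH)
          (fun n => decayTilde f (n * Real.exp (j n)))) ∧
    -- the three special cases
    (∀ j : ℕ → ℝ, IsDistorted (fun n => n + j n) (LG ∘ iG) (LH ∘ iH) →
      (j =O[atTop] (fun n : ℕ => Real.log n) → HasRDWith LG → HasRDWith LH →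
        HasRD (Amalgam iG iH) ∧
          (ZerosInAmalgam iG iH LG LH → HasRDWith (universalLength iG iH LG LH))) ∧
      (j =o[atTop] (fun n : ℕ => (n : ℝ)) → HasRDWith LG → HasRDWith LH →
        HasSD (Amalgam iG iH) ∧
          (ZerosInAmalgam iG iH LG LH → HasSDWith (universalLength iG iH LG LH))) ∧
      (j =O[atTop] (fun _ : ℕ => (1 : ℝ)) → HasSDWith LG → HasSDWith LH →
        HasSD (Amalgam iG iH) ∧
          (ZerosInAmalgam iG iH LG LH → HasSDWith (universalLength iG iH LG LH)))) := by
  exact ⟨isLengthFunction_universalLength iG iH hLG hLH,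
    fun hz _ _ hj hj' hd hG hH =>
      hasDecay_universalLength_decayTilde hiG hiH hLG hLH hz hj hj' hd hG hH,
    fun _ hd => ⟨hasRD_amalgam hiG hiH hLG hLH hd, hasSD_amalgam_of_isLittleO hiG hiH hLG hLH hd,
      hasSD_amalgam_of_isBigO_one hiG hiH hLG hLH hd⟩⟩
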